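/- Let $m,N\ge 1$ and let $\alpha_1,\dots,\alpha_m\ge 0$, $\beta_1,\dots,\beta_N\ge 0$ satisfy $\alpha_i+\beta_j>0$ for all $i,j$. Let $\omega_{i,j}$ ($1\le i\le m$, $1\le j\le N$) be independent exponential random variables, $\omega_{i,j}$ having rate $\alpha_i+\beta_j$. Let $x_1\le x_2\le\cdots\le x_N$ be real numbers, and let $G$ be the exponential last passage growth function $$G(i,j)=\max\{G(i-1,j),\,G(i,j-1)\}+\omega_{i,j},\qquad 1\le i\le m,\ 1\le j\le N,$$ with $G(0,j)=x_j$ and $G(i,0)=c$, where $c\in[-\infty,x_1]$ is a constant (for instance $c=-\infty$, or $c=0$ if $x_1\ge 0$). Let $0=n_0<n_1<\cdots<n_p=N$ be integers, let $h_1\le h_2\le\cdots\le h_p$ be real numbers, and set $h(j)=h_k$ for $j\in(n_{k-1},n_k]$. Let $R>\max_{k,j}\{\alpha_k,\beta_j\}$ and, for $1\le i,j\le N$, $$F_{\mathrm{Exp}}(i,j\,|\,x)=\frac{1}{2\pi \mathbf{i}}\oint_{|z|=R}dz\;e^{h(j)(z-\beta_j)-x_i(z-\beta_i)}\,\frac{\prod_{k=1}^{j-1}(z-\beta_k)}{\prod_{k=1}^{i}(z-\beta_k)}\,\prod_{k=1}^m\frac{\alpha_k+\beta_j}{z+\alpha_k},$$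 the circle being oriented counter-clockwise. Then, if $h_k\ge x_N$ for every $k$ (for example, if $x=0$ and all $h_k\ge 0$), $$\mathbf{P}\big(G(m,n_1)\le h_1,\dots,G(m,n_p)\le h_p\big)=\det\big[F_{\mathrm{Exp}}(i,j\,|\,x)\big]_{1\le i,j\le N}.$$ In general, without this condition on the $h_k$, $$\mathbf{P}\big(G(m,n_1)\le h_1,\dots,G(m,n_p)\le h_p\big)=\det\big[\mathbf{1}_{\{x_i\le h(j)\}}\,F_{\mathrm{Exp}}(i,j\,|\,x)\big]_{1\le i,j\le N}.$$ -/

import Mathlib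

/-- The last passage growth function `G(i,j)` built from deterministic weights `w i j`
(only the weights with `i, j ≥ 1` are used):
`G(i,j) = max {G(i-1,j), G(i,j-1)} + w(i,j)` for `i, j ≥ 1`, with boundary values
`G(i,0) = c` for every `i`, and `G(0,j) = x j` for `j ≥ 1`.
The constant `c` may be a real number or `-∞ = ⊥`, hence the values in `EReal`. -/
noncomputable def lppGrowth (c : EReal) (x : ℕ → ℝ) (w : ℕ → ℕ → ℝ) : ℕ → ℕ → EReal
  | _, 0 => c
  | 0, j + 1 => (x (j + 1) : EReal)
  | i + 1, j + 1 =>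
      max (lppGrowth c x w i (j + 1)) (lppGrowth c x w (i + 1) j) + (w (i + 1) (j + 1) : EReal)
  termination_by i j => i + j

/-- The step function `j ↦ h(j)`, equal to `h_k` for `j ∈ (n_{k-1}, n_k]`, `k = 1, …, p`.
Here `n_0, …, n_p` are the values of `n : Fin (p + 1) → ℕ`, and `h_k` is stored as the value
of `h` at the `k`-th element of `Fin p`, whose `castSucc` is `k - 1` and whose `succ` is `k`. -/
noncomputable def stepHeight {p : ℕ} (n : Fin (p + 1) → ℕ) (h : Fin p → ℝ) (j : ℕ) : ℝ :=
  ∑ k : Fin p, if j ∈ Finset.Ioc (n k.castSucc) (n k.succ) then h k else 0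

theorem stepHeight_eq {p : ℕ} {n : Fin (p + 1) → ℕ} (hn : StrictMono n) (h : Fin p → ℝ)
    (k : Fin p) {j : ℕ} (hj : j ∈ Finset.Ioc (n k.castSucc) (n k.succ)) :
    stepHeight n h j = h k := by
  unfold stepHeight
  rw [Finset.sum_eq_single k]
  · simp [hj]
  · intro l _ hlk
    refine if_neg fun hl => ?_
    rw [Finset.mem_Ioc] at hj hl
    rcases lt_or_gt_of_ne hlk with hlt | hlt
    · have := hn.monotone (show l.succ ≤ k.castSucc from hlt)
      omega
    · have := hn.monotone (show k.succ ≤ l.castSucc from hlt)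
      omega
  · simp

/-- The contour integral
`(2πi)⁻¹ ∮_{|z|=R} e^{H(j)(z-β_j) - x_i(z-β_i)}
  (∏_{k=1}^{j-1} (z-β_k)) / (∏_{k=1}^{i} (z-β_k)) ∏_{k=1}^m (α_k+β_j)/(z+α_k) dz`,
with the circle oriented counter-clockwise (indices `i, j ≥ 1`). -/
noncomputable def FExp (m : ℕ) (α β x H : ℕ → ℝ) (R : ℝ) (i j : ℕ) : ℂ :=
  (2 * (Real.pi : ℂ) * Complex.I)⁻¹ *
    ∮ z in C(0, R),
      Complex.exp ((H j : ℂ) * (z - (β j : ℂ)) - (x i : ℂ) * (z - (β i : ℂ))) *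
        ((∏ k ∈ Finset.Icc 1 (j - 1), (z - (β k : ℂ))) /
          (∏ k ∈ Finset.Icc 1 i, (z - (β k : ℂ)))) *
        ∏ k ∈ Finset.Icc 1 m, (((α k : ℂ) + (β j : ℂ)) / (z + (α k : ℂ)))

/-! Fix an initial row and look at determinants `det[e^{b_i y_i} F_{i,l}(y_i)]` (`rowDet`), where
the functions form a tower: `F_{i,l} = -(d/ds + b_{i+1}) F_{i+1,l}`, all vanishing on `[B, ∞)`.
Averaging such a determinant over one new row of the growth, with row parameter `a`, gives a
determinant of the same kind at the old row: each `F_{i,l}` is replaced by `expTail B a F_{i,l}`,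
and a factor `∏_j (a + b_j)` appears.

This is proved one site at a time (`integral_siteDet_update`). Site `j` moves to `t = max(y_j,
y_{j-1}) + Exp(a + b_j)`. Combined with the row weight `e^{b_j t}`, the exponential density becomes
`e^{-a t}` up to a constant, and `e^{-a t} F_j` is minus the derivative of `e^{-a t} expTail B a
F_j`. The rows `i > j` hold weighted functions at `max(y_i, t)`. Where such a row moves with `t`,
the tower relation makes its derivative proportional to the row above it, so it does not contribute
to the derivative of the determinant (`hasDerivWithinAt_det_siteMatrix`). The integrand is therefore
a total derivative. Independence lets the sites be removed from the last to the first, which yields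
`integral_rowDet_growthRow`.

To extract probabilities, the columns are built from test functions so that on ordered vectors the
determinant is the product of its diagonal entries (`rowDet_testTower`), each a smoothed indicator
of `{y_l ≤ h_l}`. On the other side, under `u ↦ ∫_s^B e^{z(y-s)} u(y) dy` the tail operators become
factors `(z + a_k)⁻¹` and `(z - b_k)⁻¹`, and the differential operators become factors `z - b_k`.
The entries are then contour integrals (`expTails_eq_circleIntegral`, `expTails_testTower`).
Shrinking the test functions to point masses at `h_l` from the right gives the formula. The
indicator of `{x_i ≤ h(j)}` remains because an entry vanishes once the support lies to the left of
`x_i`. -/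

/-! ### Exponential tail operators -/

/-- The operator `u ↦ ∫_s^B e^{-a(y-s)} u(y) dy`, the inverse of `a - d/ds` on functions that
vanish at `B`. -/
noncomputable def expTail (B : ℝ) (a : ℂ) (u : ℝ → ℂ) (s : ℝ) : ℂ :=
  ∫ y in s..B, Complex.exp (-a * ((y : ℂ) - s)) * u y

theorem expTail_eq_exp_mul (B : ℝ) (a : ℂ) (u : ℝ → ℂ) (s : ℝ) :
    expTail B a u s = Complex.exp (a * s) * ∫ y in s..B, Complex.exp (-a * y) * u y := by
  rw [expTail, ← intervalIntegral.integral_const_mul]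
  congr 1
  ext y
  rw [← mul_assoc, ← Complex.exp_add]
  congr 2
  ring

theorem hasDerivAt_cexp_mul_ofReal (a : ℂ) (s : ℝ) :
    HasDerivAt (fun s : ℝ => Complex.exp (a * s)) (a * Complex.exp (a * s)) s := by
  have h1 : HasDerivAt (fun s : ℝ => a * (s : ℂ)) a s := by
    simpa using (Complex.ofRealCLM.hasDerivAt (x := s)).const_mul a
  simpa [mul_comm] using h1.cexp

theorem hasDerivAt_expTail (B : ℝ) (a : ℂ) {u : ℝ → ℂ} (hu : Continuous u) (s : ℝ) :
    HasDerivAt (expTail B a u) (a * expTail B a u s - u s) s := by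
  have hc : Continuous fun y : ℝ => Complex.exp (-a * y) * u y := by fun_prop
  have h1 : HasDerivAt (fun s : ℝ => ∫ y in s..B, Complex.exp (-a * y) * u y)
      (-(Complex.exp (-a * s) * u s)) s :=
    intervalIntegral.integral_hasDerivAt_left (hc.intervalIntegrable _ _)
      (hc.stronglyMeasurableAtFilter _ _) hc.continuousAt
  have h2 := (hasDerivAt_cexp_mul_ofReal a s).mul h1
  have he : expTail B a u = fun s : ℝ =>
      Complex.exp (a * s) * ∫ y in s..B, Complex.exp (-a * y) * u y :=
    funext (expTail_eq_exp_mul B a u)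
  rw [he]
  refine h2.congr_deriv ?_
  have : Complex.exp (a * s) * Complex.exp (-a * s) = 1 := by
    rw [← Complex.exp_add]; simp
  linear_combination (-u s) * this

theorem continuous_expTail (B : ℝ) (a : ℂ) {u : ℝ → ℂ} (hu : Continuous u) :
    Continuous (expTail B a u) :=
  continuous_iff_continuousAt.2 fun s => (hasDerivAt_expTail B a hu s).continuousAt

theorem expTail_self (B : ℝ) (a : ℂ) (u : ℝ → ℂ) : expTail B a u B = 0 := by
  simp [expTail]

theorem expTail_eq_zero {B : ℝ} (a : ℂ) {u : ℝ → ℂ} (hu : ∀ y, B ≤ y → u y = 0) {s : ℝ}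
    (hs : B ≤ s) : expTail B a u s = 0 := by
  rw [expTail, intervalIntegral.integral_congr (g := fun _ => (0 : ℂ))]
  · simp
  · intro y hy
    rw [Set.uIcc_of_ge hs] at hy
    simp [hu y hy.1]

/-- `expTail B a u` is the only solution of `v' = a v - u` with `v B = 0`. -/
theorem eq_expTail_of_hasDerivAt {B : ℝ} {a : ℂ} {u v : ℝ → ℂ} (hu : Continuous u)
    (hv : ∀ s, HasDerivAt v (a * v s - u s) s) (hB : v B = 0) : v = expTail B a u := by
  have hd : ∀ s, HasDerivAt
      (fun s : ℝ => Complex.exp (-a * s) * (v s - expTail B a u s)) 0 s := by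
    intro s
    have := (hasDerivAt_cexp_mul_ofReal (-a) s).mul ((hv s).sub (hasDerivAt_expTail B a hu s))
    refine this.congr_deriv ?_
    simp only [Pi.sub_apply]
    ring
  have hconst := is_const_of_deriv_eq_zero (fun s => (hd s).differentiableAt)
    (fun s => (hd s).deriv)
  ext s
  have h := hconst s B
  simp only [hB, expTail_self, sub_self, mul_zero, mul_eq_zero, Complex.exp_ne_zero,
    false_or] at h
  exact sub_eq_zero.1 h

/-- The resolvent identity. -/
theorem expTail_expTail {B : ℝ} {a z : ℂ} (hz : z + a ≠ 0) {u : ℝ → ℂ} (hu : Continuous u)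
    (s : ℝ) :
    expTail B (-z) (expTail B a u) s = (z + a)⁻¹ * (expTail B (-z) u s - expTail B a u s) := by
  have h : (fun s => (z + a)⁻¹ * (expTail B (-z) u s - expTail B a u s)) =
      expTail B (-z) (expTail B a u) := by
    refine eq_expTail_of_hasDerivAt (continuous_expTail B a hu) (fun s => ?_) ?_
    · refine (((hasDerivAt_expTail B (-z) hu s).sub
        (hasDerivAt_expTail B a hu s)).const_mul _).congr_deriv ?_
      field_simp
      ring
    · simp [expTail_self]
  exact (congrFun h s).symm

/-- An integration by parts, done through uniqueness for the first-order equation. The boundary term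
at `B` vanishes and the one at `s` is the summand `u s`. Up to that term, the differential operator
acts as multiplication by `z - b`. -/
theorem expTail_neg_deriv {B : ℝ} (b z : ℂ) {u u' : ℝ → ℂ} (hu' : Continuous u')
    (hu : ∀ s, HasDerivAt u (u' s) s) (hB : u B = 0) (s : ℝ) :
    expTail B (-z) (fun t => -(u' t + b * u t)) s = (z - b) * expTail B (-z) u s + u s := by
  have huc : Continuous u := continuous_iff_continuousAt.2 fun s => (hu s).continuousAt
  have h : (fun s => (z - b) * expTail B (-z) u s + u s) =
      expTail B (-z) (fun t => -(u' t + b * u t)) := by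
    refine eq_expTail_of_hasDerivAt (by fun_prop) (fun s => ?_) ?_
    · refine (((hasDerivAt_expTail B (-z) huc s).const_mul _).add (hu s)).congr_deriv ?_
      ring
    · simp [expTail_self, hB]
  exact (congrFun h s).symm

/-- The integral runs over a bounded interval, so differentiation under it is dominated locally in
`z`. Being entire in `z` is what Cauchy's formula needs. -/
theorem differentiable_expTail_neg (B : ℝ) {u : ℝ → ℂ} (hu : Continuous u) (s : ℝ) :
    Differentiable ℂ fun z => expTail B (-z) u s := by
  intro z₀
  simp only [expTail, neg_neg]
  have hF' : Continuous fun p : ℂ × ℝ =>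
      ((p.2 : ℂ) - s) * Complex.exp (p.1 * ((p.2 : ℂ) - s)) * u p.2 := by fun_prop
  obtain ⟨C, hC⟩ := ((isCompact_closedBall z₀ 1).prod
    (isCompact_uIcc (a := s) (b := B))).exists_bound_of_continuousOn hF'.continuousOn
  refine (intervalIntegral.hasDerivAt_integral_of_dominated_loc_of_deriv_le
    (F' := fun z y => ((y : ℂ) - s) * Complex.exp (z * ((y : ℂ) - s)) * u y)
    (bound := fun _ => C) (Metric.closedBall_mem_nhds z₀ one_pos)
    (Filter.Eventually.of_forall fun z => Continuous.aestronglyMeasurable (by fun_prop))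
    (Continuous.intervalIntegrable (by fun_prop) _ _)
    (Continuous.aestronglyMeasurable (by fun_prop))
    (Filter.Eventually.of_forall fun y hy z hz =>
      hC (z, y) ⟨hz, Set.uIoc_subset_uIcc hy⟩)
    intervalIntegrable_const (Filter.Eventually.of_forall fun y _ z _ => ?_)).2.differentiableAt
  have := (((hasDerivAt_id z).mul_const ((y : ℂ) - s)).cexp).mul_const (u y)
  refine this.congr_deriv ?_
  simp only [id]
  ring

/-- The composition of the operators `expTail B a`, `a ∈ L`, the last element of `L` acting
first. -/
noncomputable def expTails (B : ℝ) (L : List ℂ) (u : ℝ → ℂ) : ℝ → ℂ :=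
  L.foldr (fun a v => expTail B a v) u

theorem continuous_expTails (B : ℝ) (L : List ℂ) {u : ℝ → ℂ} (hu : Continuous u) :
    Continuous (expTails B L u) := by
  induction L with
  | nil => exact hu
  | cons a L ih => exact continuous_expTail B a ih

theorem expTails_append (B : ℝ) (L L' : List ℂ) (u : ℝ → ℂ) :
    expTails B (L ++ L') u = expTails B L (expTails B L' u) := by
  simp [expTails]

/-! ### The contour representation -/

theorem add_ne_zero_of_mem_sphere {R : ℝ} {a z : ℂ} (ha : ‖a‖ < R)
    (hz : z ∈ Metric.sphere (0 : ℂ) R) : z + a ≠ 0 := by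
  intro h
  rw [eq_neg_of_add_eq_zero_left h] at hz
  simp at hz
  linarith

theorem continuousOn_prod_inv {R : ℝ} (L : List ℂ) (hL : ∀ a ∈ L, ‖a‖ < R) :
    ContinuousOn (fun z => (L.map fun a => (z + a)⁻¹).prod) (Metric.sphere (0 : ℂ) R) := by
  induction L with
  | nil => simpa using continuousOn_const
  | cons a L ih =>
    simp only [List.map_cons, List.prod_cons]
    refine ContinuousOn.mul (ContinuousOn.inv₀ (by fun_prop) fun z hz =>
      add_ne_zero_of_mem_sphere (hL a (by simp)) hz) (ih fun b hb => hL b (by simp [hb]))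

theorem norm_prod_inv_le {r R : ℝ} (hr : r < R) (L : List ℂ) (hL : ∀ a ∈ L, ‖a‖ ≤ r) {z : ℂ}
    (hz : ‖z‖ = R) : ‖(L.map fun a => (z + a)⁻¹).prod‖ ≤ ((R - r) ^ L.length)⁻¹ := by
  induction L with
  | nil => simp
  | cons a L ih =>
    simp only [List.map_cons, List.prod_cons, List.length_cons, norm_mul, norm_inv, pow_succ',
      mul_inv]
    have ha := hL a (by simp)
    have h1 : R - r ≤ ‖z + a‖ := by
      have := norm_sub_norm_le z (-a)
      rw [norm_neg, sub_neg_eq_add] at this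
      linarith
    have h2 : 0 < R - r := by linarith
    gcongr
    exact ih fun b hb => hL b (by simp [hb])

/-- All poles lie inside the circle, so the radius may grow without changing the integral, while two
or more factors make the integrand decay at least quadratically. -/
theorem circleIntegral_prod_inv_eq_zero {R : ℝ} (hR : 0 < R) (L : List ℂ)
    (hL : ∀ a ∈ L, ‖a‖ < R) (h2 : 2 ≤ L.length) :
    ∮ z in C(0, R), (L.map fun a => (z + a)⁻¹).prod = 0 := by
  obtain ⟨r, hr0, hrR, hr⟩ : ∃ r, 0 ≤ r ∧ r < R ∧ ∀ a ∈ L, ‖a‖ ≤ r := by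
    clear h2
    induction L with
    | nil => exact ⟨0, le_rfl, hR, by simp⟩
    | cons a L ih =>
      obtain ⟨r, h0, h1, h2⟩ := ih fun b hb => hL b (by simp [hb])
      refine ⟨max r ‖a‖, le_max_of_le_left h0, max_lt h1 (hL a (by simp)), fun b hb => ?_⟩
      rcases List.mem_cons.1 hb with rfl | hb
      · exact le_max_right _ _
      · exact (h2 b hb).trans (le_max_left _ _)
  have heq : ∀ R', R ≤ R' → ∮ z in C(0, R'), (L.map fun a => (z + a)⁻¹).prod =
      ∮ z in C(0, R), (L.map fun a => (z + a)⁻¹).prod := by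
    intro R' hR'
    have hd : ∀ z : ℂ, R ≤ ‖z‖ →
        DifferentiableAt ℂ (fun z => (L.map fun a => (z + a)⁻¹).prod) z := by
      intro z hz
      clear h2
      induction L with
      | nil => simp
      | cons a L ih =>
        simp only [List.map_cons, List.prod_cons]
        refine DifferentiableAt.mul (DifferentiableAt.inv (by fun_prop) fun h => ?_)
          (ih (fun b hb => hL b (by simp [hb])) fun b hb => hr b (by simp [hb]))
        have := hL a (by simp)
        rw [eq_neg_of_add_eq_zero_left h, norm_neg] at hz
        linarith
    refine Complex.circleIntegral_eq_of_differentiable_on_annulus_off_countable hR hR'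
      Set.countable_empty (fun z hz => (hd z ?_).continuousAt.continuousWithinAt) fun z hz => hd z ?_
    · simpa using hz.2
    · have := hz.1.2
      simp at this
      exact this.le
  have hbound : ∀ R', R ≤ R' → ‖∮ z in C(0, R), (L.map fun a => (z + a)⁻¹).prod‖ ≤
      2 * Real.pi * R' * ((R' - r) ^ L.length)⁻¹ := by
    intro R' hR'
    rw [← heq R' hR']
    refine circleIntegral.norm_integral_le_of_norm_le_const (by linarith) fun z hz => ?_
    exact norm_prod_inv_le (by linarith) L hr (by simpa using hz)
  -- The bound is used at radius `t + r`, which keeps the circle at distance at least `t` from every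
  -- pole.
  have hlim : Filter.Tendsto (fun t : ℝ => 2 * Real.pi * (1 + r) * t⁻¹) Filter.atTop (nhds 0) := by
    simpa using tendsto_inv_atTop_zero.const_mul (2 * Real.pi * (1 + r))
  rw [← norm_le_zero_iff]
  refine ge_of_tendsto hlim ?_
  filter_upwards [Filter.eventually_ge_atTop (max 1 R)] with t ht
  have ht1 : 1 ≤ t := (le_max_left _ _).trans ht
  have htR : R ≤ t := (le_max_right _ _).trans ht
  refine (hbound (t + r) (by linarith)).trans ?_
  rw [add_sub_cancel_right]
  have h3 : t ^ 2 ≤ t ^ L.length := pow_le_pow_right₀ ht1 h2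
  have h4 : (t ^ L.length)⁻¹ ≤ (t ^ 2)⁻¹ := inv_anti₀ (by positivity) h3
  have h5 : t + r ≤ (1 + r) * t := by nlinarith
  calc 2 * Real.pi * (t + r) * (t ^ L.length)⁻¹
      ≤ 2 * Real.pi * ((1 + r) * t) * (t ^ 2)⁻¹ := by gcongr
    _ = 2 * Real.pi * (1 + r) * t⁻¹ := by field_simp

/-- The composition of exponential tail operators as a contour integral. -/
theorem expTails_eq_circleIntegral {B R : ℝ} (hR : 0 < R) (L : List ℂ) (hne : L ≠ [])
    (hL : ∀ a ∈ L, ‖a‖ < R) {u : ℝ → ℂ} (hu : Continuous u) (s : ℝ) :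
    expTails B L u s = (2 * (Real.pi : ℂ) * Complex.I)⁻¹ *
      ∮ z in C(0, R), (L.map fun a => (z + a)⁻¹).prod * expTail B (-z) u s := by
  have hpi : (2 * (Real.pi : ℂ) * Complex.I) ≠ 0 := Complex.two_pi_I_ne_zero
  induction L using List.reverseRecOn generalizing u with
  | nil => exact absurd rfl hne
  | append_singleton L a ih =>
    have haR : ‖a‖ < R := hL a (by simp)
    -- A single operator is Cauchy's formula at the point `-a`. Otherwise the innermost operator is
    -- absorbed into `u` and the induction hypothesis applies to the rest.
    rcases eq_or_ne L [] with rfl | hL0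
    · have h := Complex.circleIntegral_sub_inv_smul_of_differentiable_on_off_countable
        (c := 0) (R := R) (w := -a) Set.countable_empty (by simpa using haR)
        (differentiable_expTail_neg B hu s).continuous.continuousOn
        fun z _ => differentiable_expTail_neg B hu s z
      simp only [sub_neg_eq_add, smul_eq_mul, neg_neg] at h
      simp only [List.nil_append, List.map_cons, List.map_nil, List.prod_cons, List.prod_nil,
        mul_one, expTails, List.foldr]
      rw [h, inv_mul_cancel_left₀ hpi]
    · rw [expTails_append, show expTails B [a] u = expTail B a u from rfl,
        ih hL0 (fun b hb => hL b (by simp [hb])) (continuous_expTail B a hu)]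
      congr 1
      have hcont := continuousOn_prod_inv (L ++ [a]) hL
      have hEc : Continuous fun z => expTail B (-z) u s :=
        (differentiable_expTail_neg B hu s).continuous
      have hz := circleIntegral_prod_inv_eq_zero hR (L ++ [a]) hL (by
        have := List.length_pos_iff.2 hL0
        simp; omega)
      -- The resolvent identity splits the integrand. In the second piece `expTail B a u s` does not
      -- depend on `z`, and the remaining product has at least two factors, so its integral
      -- vanishes.
      have e : ∮ z in C(0, R), (L.map fun a => (z + a)⁻¹).prod *
            expTail B (-z) (expTail B a u) s =
          ∮ z in C(0, R), (((L ++ [a]).map fun a => (z + a)⁻¹).prod * expTail B (-z) u s -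
            ((L ++ [a]).map fun a => (z + a)⁻¹).prod * expTail B a u s) := by
        refine circleIntegral.integral_congr hR.le fun z hz => ?_
        simp only [List.map_append, List.map_cons, List.map_nil, List.prod_append,
          List.prod_cons, List.prod_nil, mul_one]
        rw [expTail_expTail (add_ne_zero_of_mem_sphere haR hz) hu]
        ring
      rw [e, circleIntegral.integral_sub]
      · have : ∀ (f : ℂ → ℂ) (c : ℂ), ∮ z in C(0, R), f z * c = (∮ z in C(0, R), f z) * c := by
          intro f c
          simp [mul_comm, circleIntegral.integral_const_mul]
        rw [this, hz, zero_mul, sub_zero]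
      · exact (hcont.mul hEc.continuousOn).circleIntegrable hR.le
      · exact (hcont.mul continuousOn_const).circleIntegrable hR.le

/-! ### Derivative of a determinant -/

/-- The Leibniz rule on the permutation expansion, regrouped by rows. One-sided derivatives are
allowed because the entries will involve `max (y i) t`, which has a corner. -/
theorem hasDerivWithinAt_det {N : ℕ} {A : ℝ → Matrix (Fin N) (Fin N) ℂ}
    {A' : Matrix (Fin N) (Fin N) ℂ} {s : Set ℝ} {t : ℝ}
    (h : ∀ i l, HasDerivWithinAt (fun t => A t i l) (A' i l) s t) :
    HasDerivWithinAt (fun t => (A t).det) (∑ k, ((A t).updateRow k (A' k)).det) s t := by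
  have hdet : ∀ M : Matrix (Fin N) (Fin N) ℂ, M.det =
      ∑ σ : Equiv.Perm (Fin N), ((Equiv.Perm.sign σ : ℤ) : ℂ) * ∏ i, M i (σ i) := by
    intro M
    rw [← Matrix.det_transpose, Matrix.det_apply']
    rfl
  simp only [hdet]
  have h1 := HasDerivWithinAt.fun_sum (u := (Finset.univ : Finset (Equiv.Perm (Fin N))))
    fun σ _ => (HasDerivWithinAt.fun_finsetProd (u := Finset.univ)
      fun i _ => h i (σ i)).const_mul ((Equiv.Perm.sign σ : ℤ) : ℂ)
  refine h1.congr_deriv ?_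
  rw [Finset.sum_comm]
  refine Finset.sum_congr rfl fun σ _ => ?_
  rw [Finset.mul_sum]
  refine Finset.sum_congr rfl fun k _ => ?_
  rw [← Finset.mul_prod_erase _ _ (Finset.mem_univ k), Matrix.updateRow_self, smul_eq_mul,
    mul_comm (A' k (σ k))]
  congr 2
  refine Finset.prod_congr rfl fun i hi => ?_
  rw [Matrix.updateRow_ne (Finset.ne_of_mem_erase hi)]

/-! ### Towers of functions -/

/-- A family `F i l` of continuous functions that vanish on `[B, ∞)`, with
`F i l = -(d/ds + b (i+1)) F (i+1) l`. -/
structure IsTower (B : ℝ) (b : ℕ → ℝ) (F : ℕ → ℕ → ℝ → ℂ) : Prop where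
  continuous : ∀ i l, Continuous (F i l)
  hasDerivAt : ∀ i l s, HasDerivAt (F (i + 1) l) (-(b (i + 1) * F (i + 1) l s) - F i l s) s
  eq_zero : ∀ i l s, B ≤ s → F i l s = 0

/-- The tail operator commutes with the operators linking the rows: the expression in `h` solves the
equation that characterises `expTail B a (F i l)`. -/
theorem IsTower.expTail {B : ℝ} {b : ℕ → ℝ} {F : ℕ → ℕ → ℝ → ℂ} (hF : IsTower B b F) (a : ℂ) :
    IsTower B b fun i l => expTail B a (F i l) where
  continuous i l := continuous_expTail B a (hF.continuous i l)
  eq_zero i l s hs := expTail_eq_zero a (hF.eq_zero i l) hs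
  hasDerivAt i l s := by
    have h : (fun s => F (i + 1) l s - (a + b (i + 1)) * _root_.expTail B a (F (i + 1) l) s) =
        _root_.expTail B a (F i l) := by
      refine eq_expTail_of_hasDerivAt (hF.continuous i l) (fun s => ?_) ?_
      · refine ((hF.hasDerivAt i l s).sub
          ((hasDerivAt_expTail B a (hF.continuous (i + 1) l) s).const_mul _)).congr_deriv ?_
        ring
      · simp [hF.eq_zero _ _ _ le_rfl, expTail_self]
    refine (hasDerivAt_expTail B a (hF.continuous (i + 1) l) s).congr_deriv ?_
    rw [← congrFun h s]
    ring

/-- The weighted function `t ↦ e^{b t} u t`. -/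
noncomputable def expWeight (b : ℝ) (u : ℝ → ℂ) (t : ℝ) : ℂ := Complex.exp ((b : ℂ) * t) * u t

theorem continuous_expWeight (b : ℝ) {u : ℝ → ℂ} (hu : Continuous u) :
    Continuous (expWeight b u) := by
  unfold expWeight
  fun_prop

/-! ### The update of one site -/

/-- The determinant in which the rows `i < j` hold the functions `F i` at `y i` and the rows
`i ≥ j` the functions `G i` at `max (y i) (y (j - 1))`. -/
noncomputable def siteDet (N : ℕ) (b : ℕ → ℝ) (F G : ℕ → ℕ → ℝ → ℂ) (j : ℕ) (y : ℕ → ℝ) : ℂ :=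
  Matrix.det (Matrix.of fun i l : Fin N =>
    if (i : ℕ) < j then expWeight (b i) (F i l) (y i)
    else expWeight (b i) (G i l) (max (y i) (y (j - 1))))

/-- The matrix with constant rows `c i` for `i < j`, the functions `r` at `t` in row `j`, and the
weighted functions `G i` at `max (y i) t` in the rows `i > j`. -/
noncomputable def siteMatrix {N : ℕ} (b : ℕ → ℝ) (c : ℕ → ℕ → ℂ) (G : ℕ → ℕ → ℝ → ℂ) (y : ℕ → ℝ)
    (j : Fin N) (r : ℕ → ℝ → ℂ) (t : ℝ) : Matrix (Fin N) (Fin N) ℂ :=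
  Matrix.of fun i l : Fin N =>
    if i < j then c i l else if i = j then r l t
    else expWeight (b i) (G i l) (max (y i) t)

theorem siteMatrix_updateRow {N : ℕ} (b : ℕ → ℝ) (c : ℕ → ℕ → ℂ) (G : ℕ → ℕ → ℝ → ℂ)
    (y : ℕ → ℝ) (j : Fin N) (r r' : ℕ → ℝ → ℂ) (t : ℝ) :
    (siteMatrix b c G y j r t).updateRow j (fun l => r' l t) = siteMatrix b c G y j r' t := by
  ext i l
  rcases eq_or_ne i j with rfl | h
  · simp [siteMatrix]
  · simp [siteMatrix, h]

theorem det_siteMatrix_smul {N : ℕ} (b : ℕ → ℝ) (c : ℕ → ℕ → ℂ) (G : ℕ → ℕ → ℝ → ℂ)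
    (y : ℕ → ℝ) (j : Fin N) (r : ℕ → ℝ → ℂ) (t : ℝ) (q : ℝ → ℂ) :
    (siteMatrix b c G y j (fun l t => q t * r l t) t).det =
      q t * (siteMatrix b c G y j r t).det := by
  rw [← siteMatrix_updateRow b c G y j r (fun l t => q t * r l t) t]
  change ((siteMatrix b c G y j r t).updateRow j (q t • fun l : Fin N => r l t)).det = _
  rw [Matrix.det_updateRow_smul, siteMatrix_updateRow]

theorem det_updateRow_smul_eq_zero {N : ℕ} (M : Matrix (Fin N) (Fin N) ℂ) {i k : Fin N}
    (h : k ≠ i) (q : ℂ) : (M.updateRow i (q • M k)).det = 0 := by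
  rw [Matrix.det_updateRow_smul, Matrix.det_updateRow_eq_zero h, mul_zero]

theorem hasDerivWithinAt_max_const {u : ℝ → ℂ} {d : ℂ} {y t : ℝ} (h : HasDerivAt u d t) :
    HasDerivWithinAt (fun t => u (max y t)) (if t < y then 0 else d) (Set.Ioi t) t := by
  split_ifs with hy
  · refine (hasDerivWithinAt_const t _ (u y)).congr_of_eventuallyEq ?_ (by
      rw [max_eq_left hy.le])
    filter_upwards [mem_nhdsWithin_of_mem_nhds (Iio_mem_nhds hy)] with s hs
    rw [max_eq_left (le_of_lt hs)]
  · rw [not_lt] at hy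
    refine h.hasDerivWithinAt.congr (fun s hs => ?_) (by rw [max_eq_right hy])
    rw [max_eq_right (hy.trans (le_of_lt hs))]

/-- The cancellation behind the whole proof. Of the row-by-row derivative terms only that of row `j`
survives: earlier rows are constant, and each later row has derivative zero or proportional to its
predecessor, giving a determinant with two proportional rows. -/
theorem hasDerivWithinAt_det_siteMatrix {N : ℕ} {B : ℝ} {b : ℕ → ℝ} {F : ℕ → ℕ → ℝ → ℂ}
    (hF : IsTower B b F) (a : ℝ) (c : ℕ → ℕ → ℂ) {y : ℕ → ℝ} (j : Fin N)
    (hy : ∀ i : ℕ, (j : ℕ) < i → i + 1 < N → y i ≤ y (i + 1)) (t : ℝ) :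
    HasDerivWithinAt (fun t => (siteMatrix b c (fun i l => expTail B a (F i l)) y j
        (fun l t => Complex.exp (-a * t) * expTail B a (F j l) t) t).det)
      (-(siteMatrix b c (fun i l => expTail B a (F i l)) y j
        (fun l t => Complex.exp (-a * t) * F j l t) t).det) (Set.Ioi t) t := by
  have hG := hF.expTail (a : ℂ)
  set G : ℕ → ℕ → ℝ → ℂ := fun i l => expTail B a (F i l) with hGdef
  set r : ℕ → ℝ → ℂ := fun l t => Complex.exp (-a * t) * G j l t
  set r' : ℕ → ℝ → ℂ := fun l t => Complex.exp (-a * t) * F j l t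
  set A' : Matrix (Fin N) (Fin N) ℂ := fun i l =>
    if i < j then 0 else if i = j then -r' l t
    else if t < y i then 0 else -(Complex.exp ((b i : ℂ) * t) * G (i - 1) l t) with hA'
  have hent : ∀ i l, HasDerivWithinAt (fun t => siteMatrix b c G y j r t i l) (A' i l)
      (Set.Ioi t) t := by
    intro i l
    simp only [siteMatrix, Matrix.of_apply, hA']
    split_ifs with h1 h2 h3
    · exact hasDerivWithinAt_const _ _ _
    · refine (((hasDerivAt_cexp_mul_ofReal (-a) t).mul
        (hasDerivAt_expTail B a (hF.continuous j l) t)).congr_deriv ?_).hasDerivWithinAt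
      simp only [r']
      ring
    all_goals
      obtain ⟨k, hk⟩ : ∃ k, (i : ℕ) = k + 1 :=
        Nat.exists_eq_succ_of_ne_zero (by
          have : j < i := lt_of_le_of_ne (not_lt.1 h1) (Ne.symm h2)
          have : (j : ℕ) < i := this
          omega)
      have h := hasDerivWithinAt_max_const (y := y i) (t := t)
        (u := expWeight (b i) (G i l))
        (d := -(Complex.exp ((b i : ℂ) * t) * G (i - 1) l t)) (by
          rw [hk]
          refine ((hasDerivAt_cexp_mul_ofReal _ t).mul (hG.hasDerivAt k l t)).congr_deriv ?_
          simp only [Nat.add_sub_cancel]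
          ring)
      simpa [h3] using h
  refine (hasDerivWithinAt_det hent).congr_deriv ?_
  rw [Finset.sum_eq_single j]
  · have : A' j = (-1 : ℂ) • fun l : Fin N => r' l t := by
      ext l
      simp [hA']
    rw [this, Matrix.det_updateRow_smul, siteMatrix_updateRow b c G y j r r']
    ring
  · intro i _ hij
    rcases lt_or_gt_of_ne hij with h | h
    · have : A' i = 0 := by
        ext l
        simp [hA', h]
      rw [this]
      exact Matrix.det_eq_zero_of_row_eq_zero i fun l => by simp
    · have h' : (j : ℕ) < i := h
      have hi := i.isLt
      let k : Fin N := ⟨i - 1, by omega⟩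
      have hki : k ≠ i := fun e => by
        have := congrArg Fin.val e
        simp [k] at this
        omega
      have : ∃ q : ℂ, A' i = q • siteMatrix b c G y j r t k := by
        by_cases hty : t < y i
        · exact ⟨0, by ext l; simp [hA', h.not_gt, hij, hty]⟩
        -- The predecessor is row `j` itself, with weight `e^{-a t}`, or a later row with weight
        -- `e^{b_k t}`; the factor `q` compensates for the weight.
        · by_cases hkj : k = j
          · refine ⟨-(Complex.exp ((b i : ℂ) * t) * Complex.exp (a * t)), ?_⟩
            ext l
            have hj : (i : ℕ) - 1 = j := congrArg Fin.val hkj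
            simp only [hA', h.not_gt, hij, hty, if_false, siteMatrix, Matrix.of_apply, hkj,
              lt_irrefl, if_true, Pi.smul_apply, smul_eq_mul, r, hj]
            have : Complex.exp (a * t) * Complex.exp (-a * t) = 1 := by
              rw [← Complex.exp_add]; simp
            linear_combination (Complex.exp ((b i : ℂ) * t) * G j l t) * this
          · refine ⟨-(Complex.exp ((b i : ℂ) * t) * Complex.exp (-b k * t)), ?_⟩
            ext l
            have hjk : j < k := by
              refine lt_of_le_of_ne ?_ (Ne.symm hkj)
              change (j : ℕ) ≤ (i : ℕ) - 1
              omega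
            -- Monotonicity of `y` enters here: if row `i` moves with `t`, so does row `i - 1`, and
            -- both are evaluated at the same point.
            have hyk : y k ≤ t := by
              refine le_trans ?_ (not_lt.1 hty)
              have := hy (i - 1) hjk (by omega)
              rwa [Nat.sub_add_cancel (by omega)] at this
            simp only [hA', h.not_gt, hij, hty, if_false, siteMatrix, Matrix.of_apply,
              hjk.not_gt, hkj, Pi.smul_apply, smul_eq_mul, max_eq_right hyk, expWeight]
            have : Complex.exp (-b k * t) * Complex.exp (b k * t) = 1 := by
              rw [← Complex.exp_add]; simp
            have hk' : ((k : Fin N) : ℕ) = (i : ℕ) - 1 := rfl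
            rw [hk'] at this ⊢
            linear_combination (Complex.exp ((b i : ℂ) * t) * G (i - 1) l t) * this
      obtain ⟨q, hq⟩ := this
      rw [hq]
      exact det_updateRow_smul_eq_zero _ hki q
  · simp

theorem continuous_det_siteMatrix {N : ℕ} (b : ℕ → ℝ) (c : ℕ → ℕ → ℂ) {G : ℕ → ℕ → ℝ → ℂ}
    (hG : ∀ i l, Continuous (G i l)) (y : ℕ → ℝ) (j : Fin N) {r : ℕ → ℝ → ℂ}
    (hr : ∀ l, Continuous (r l)) :
    Continuous fun t => (siteMatrix b c G y j r t).det := by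
  refine Continuous.matrix_det (continuous_matrix fun i l => ?_)
  simp only [siteMatrix, Matrix.of_apply]
  split_ifs
  · exact continuous_const
  · exact hr l
  · exact (continuous_expWeight _ (hG i l)).comp (by fun_prop)

theorem integral_expMeasure {r : ℝ} (hr : 0 < r) (f : ℝ → ℂ) :
    ∫ v, f v ∂(ProbabilityTheory.expMeasure r) =
      ∫ v in Set.Ioi (0 : ℝ), (r : ℂ) * Complex.exp (-(r * v)) * f v := by
  have h : ProbabilityTheory.expMeasure r =
      MeasureTheory.volume.withDensity (ProbabilityTheory.exponentialPDF r) := rfl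
  have hm : Measurable (ProbabilityTheory.exponentialPDF r) :=
    (ProbabilityTheory.measurable_exponentialPDFReal r).ennreal_ofReal
  rw [h, integral_withDensity_eq_integral_toReal_smul hm
    (Filter.Eventually.of_forall fun x => ENNReal.ofReal_lt_top),
    ← MeasureTheory.integral_indicator measurableSet_Ioi]
  refine MeasureTheory.integral_congr_ae ?_
  have h0 : ∀ᵐ v : ℝ, v ≠ 0 := MeasureTheory.Measure.ae_ne MeasureTheory.volume 0
  filter_upwards [h0] with v hv
  rw [ProbabilityTheory.exponentialPDF_eq, Set.indicator_apply]
  rcases lt_or_gt_of_ne hv with h1 | h1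
  · simp [h1.not_ge, h1.le]
  · rw [if_pos h1.le, if_pos (by simpa using h1), ENNReal.toReal_ofReal (by positivity)]
    rw [Complex.real_smul]
    push_cast
    ring

/-- Integrating out the exponential weight of the site `j`. -/
theorem integral_siteDet_update {N : ℕ} {B : ℝ} {b : ℕ → ℝ} {F : ℕ → ℕ → ℝ → ℂ}
    (hF : IsTower B b F) {a : ℝ} {j : ℕ} (hj : j < N) (hab : 0 < a + b j) {y : ℕ → ℝ}
    (hy : ∀ i : ℕ, j ≤ i → i + 1 < N → y i ≤ y (i + 1)) :
    ∫ v, siteDet N b F (fun i l => expTail B a (F i l)) (j + 1)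
        (Function.update y j (max (y j) (y (j - 1)) + v))
        ∂(ProbabilityTheory.expMeasure (a + b j)) =
      (a + b j) * siteDet N b F (fun i l => expTail B a (F i l)) j y := by
  have hG := hF.expTail (a : ℂ)
  set G : ℕ → ℕ → ℝ → ℂ := fun i l => expTail B a (F i l) with hGdef
  set M := max (y j) (y (j - 1)) with hM
  set k : Fin N := ⟨j, hj⟩ with hk
  set c : ℕ → ℕ → ℂ := fun i l => expWeight (b i) (F i l) (y i)
  set r : ℕ → ℝ → ℂ := fun l t => Complex.exp (-a * t) * G j l t with hr
  set r' : ℕ → ℝ → ℂ := fun l t => Complex.exp (-a * t) * F j l t with hr'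
  have hexp : ∀ t : ℝ, Complex.exp (-a * t) =
      Complex.exp (-((a + b j : ℝ) * t)) * Complex.exp ((b j : ℂ) * t) := fun t => by
    rw [← Complex.exp_add]
    congr 1
    push_cast
    ring
  have hle : ∀ i : ℕ, j ≤ i → i < N → y j ≤ y i := by
    intro i hi
    induction i, hi using Nat.le_induction with
    | base => exact fun _ => le_rfl
    | succ n hn ih => exact fun h => (ih (by omega)).trans (hy n hn h)
  -- The exponential density, shifted to the variable `M + v`, turns the weight `e^{b_j t}` of row
  -- `j` into `e^{-a t}`.
  have hD : ∀ v, Complex.exp (-((a + b j : ℝ) * (M + v : ℝ))) *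
      siteDet N b F G (j + 1) (Function.update y j (M + v)) =
      (siteMatrix b c G y k r' (M + v)).det := by
    intro v
    have : r' = fun l (t : ℝ) => Complex.exp (-((a + b j : ℝ) * t)) * expWeight (b j) (F j l) t := by
      ext l t
      simp only [hr', expWeight, hexp]
      ring
    rw [this, det_siteMatrix_smul b c G y k (fun l => expWeight (b j) (F j l)) (M + v)
      (fun t => Complex.exp (-((a + b j : ℝ) * t))), siteDet]
    congr 2
    ext i l
    simp only [siteMatrix, Matrix.of_apply, Nat.add_sub_cancel, Function.update_self]
    rcases lt_trichotomy i k with h | h | h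
    · have h' : (i : ℕ) < j := h
      simp [h, h'.trans (Nat.lt_succ_self j), Function.update_of_ne h'.ne, c]
    · subst h
      simp [hk]
    · have h' : j < (i : ℕ) := h
      simp [h.not_gt, h.ne', show ¬ (i : ℕ) < j + 1 by omega, Function.update_of_ne h'.ne']
  have hE : Complex.exp (-((a + b j : ℝ) * (M : ℝ))) * siteDet N b F G j y =
      (siteMatrix b c G y k r M).det := by
    have : r = fun l (t : ℝ) => Complex.exp (-((a + b j : ℝ) * t)) * expWeight (b j) (G j l) t := by
      ext l t
      simp only [hr, expWeight, hexp]
      ring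
    rw [this, det_siteMatrix_smul b c G y k (fun l => expWeight (b j) (G j l)) M
      (fun t => Complex.exp (-((a + b j : ℝ) * t))), siteDet]
    congr 2
    ext i l
    simp only [siteMatrix, Matrix.of_apply]
    rcases lt_trichotomy i k with h | h | h
    · have h' : (i : ℕ) < j := h
      simp [h, h', c]
    · subst h
      simp [hk, hM]
    -- Since `y j ≤ y i`, the maximum of `y i` with `M` forgets `y j` and keeps only `y (j - 1)`.
    · have h' : j < (i : ℕ) := h
      have := hle i h'.le i.isLt
      simp only [h.not_gt, h.ne', show ¬ (i : ℕ) < j by omega, if_false, hM]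
      congr 1
      rw [← max_assoc, max_eq_left this]
  have hcont' : Continuous fun t => (siteMatrix b c G y k r' t).det := by
    refine continuous_det_siteMatrix b c hG.continuous y k fun l => ?_
    have := hF.continuous j l
    fun_prop
  have hcont : Continuous fun t => (siteMatrix b c G y k r t).det := by
    refine continuous_det_siteMatrix b c hG.continuous y k fun l => ?_
    have := hG.continuous j l
    fun_prop
  have hzero : ∀ (s : ℕ → ℝ → ℂ) t, (∀ l, s l t = 0) → (siteMatrix b c G y k s t).det = 0 := by
    intro s t hs
    refine Matrix.det_eq_zero_of_row_eq_zero k fun l => ?_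
    simp [siteMatrix, hs]
  -- For `v ≥ L` the point `M + v` is at least `B`, where row `j` vanishes, so the half-line
  -- integral reduces to `[0, L]` and the upper boundary term is zero.
  set L := max 0 (B - M) with hL
  have hL0 : 0 ≤ L := le_max_left _ _
  have hLB : B ≤ M + L := by
    have := le_max_right 0 (B - M)
    linarith
  have hftc : ∫ t in M..(M + L), -(siteMatrix b c G y k r' t).det =
      0 - (siteMatrix b c G y k r M).det := by
    rw [intervalIntegral.integral_eq_sub_of_hasDeriv_right
      (f := fun t => (siteMatrix b c G y k r t).det) hcont.continuousOn
      (fun t _ => hasDerivWithinAt_det_siteMatrix hF a c k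
        (fun i hi h => hy i (le_of_lt hi) h) t) (hcont'.neg.intervalIntegrable _ _),
      hzero r (M + L) fun l => by simp [hr, hG.eq_zero _ _ _ hLB]]
  rw [intervalIntegral.integral_neg, zero_sub, neg_inj] at hftc
  have hunit : Complex.exp ((a + b j : ℝ) * (M : ℝ)) *
      Complex.exp (-((a + b j : ℝ) * (M : ℝ))) = 1 := by
    rw [← Complex.exp_add]; simp
  have hsplit : ∀ v : ℝ, ((a + b j : ℝ) : ℂ) * Complex.exp (-((a + b j : ℝ) * v)) *
      siteDet N b F G (j + 1) (Function.update y j (M + v)) =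
      (a + b j : ℝ) * Complex.exp ((a + b j : ℝ) * (M : ℝ)) *
        (siteMatrix b c G y k r' (M + v)).det := by
    intro v
    rw [← hD v]
    have : Complex.exp (-((a + b j : ℝ) * v)) = Complex.exp ((a + b j : ℝ) * (M : ℝ)) *
        Complex.exp (-((a + b j : ℝ) * (M + v : ℝ))) := by
      rw [← Complex.exp_add]
      congr 1
      push_cast
      ring
    rw [this]
    ring
  rw [integral_expMeasure hab]
  simp_rw [hsplit]
  rw [MeasureTheory.integral_const_mul]
  have hset : ∫ v in Set.Ioi 0, (siteMatrix b c G y k r' (M + v)).det =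
      ∫ v in Set.Ioc 0 L, (siteMatrix b c G y k r' (M + v)).det := by
    refine MeasureTheory.setIntegral_eq_of_subset_of_forall_sdiff_eq_zero measurableSet_Ioi
      (fun v hv => hv.1) fun v hv => hzero r' _ fun l => ?_
    have hvL : L < v := by
      by_contra h
      exact hv.2 ⟨hv.1, not_lt.1 h⟩
    simp [hr', hF.eq_zero _ _ _ (show B ≤ M + v by linarith)]
  rw [hset, ← intervalIntegral.integral_of_le hL0,
    intervalIntegral.integral_comp_add_left (fun t => (siteMatrix b c G y k r' t).det) M,
    add_zero, hftc, ← hE]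
  push_cast at hunit ⊢
  linear_combination ((a + b j : ℂ) * siteDet N b F G j y) * hunit

/-! ### The growth function as a chain of site updates -/

/-- The state after the sites `0, …, j - 1` of a row have been updated with the weights `w`,
starting from the previous row `y`. -/
noncomputable def rowUpdate (y w : ℕ → ℝ) : ℕ → ℕ → ℝ
  | 0 => y
  | j + 1 => Function.update (rowUpdate y w j) j
      (max (rowUpdate y w j j) (rowUpdate y w j (j - 1)) + w j)

/-- The rows of the growth function with `N` sites, started from `x`. -/
noncomputable def growthRow (N : ℕ) (x : ℕ → ℝ) (w : ℕ → ℕ → ℝ) : ℕ → ℕ → ℝ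
  | 0 => x
  | r + 1 => rowUpdate (growthRow N x w r) (w r) N

theorem rowUpdate_of_le (y w : ℕ → ℝ) {j k : ℕ} (h : j ≤ k) : rowUpdate y w j k = y k := by
  induction j with
  | zero => rfl
  | succ j ih =>
    rw [rowUpdate, Function.update_of_ne (by omega), ih (by omega)]

theorem rowUpdate_of_lt (y w : ℕ → ℝ) {j k : ℕ} (h : k < j) :
    rowUpdate y w j k = rowUpdate y w (k + 1) k := by
  induction j, (show k + 1 ≤ j from h) using Nat.le_induction with
  | base => rfl
  | succ j hj ih => rw [rowUpdate, Function.update_of_ne (by omega), ih hj]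

theorem rowUpdate_succ_self (y w : ℕ → ℝ) (k : ℕ) :
    rowUpdate y w (k + 1) k = max (y k) (rowUpdate y w k (k - 1)) + w k := by
  rw [rowUpdate, Function.update_self, rowUpdate_of_le y w le_rfl]

theorem le_rowUpdate {y w : ℕ → ℝ} (hw : ∀ i, 0 ≤ w i) (j k : ℕ) : y k ≤ rowUpdate y w j k := by
  rcases lt_or_ge k j with h | h
  · rw [rowUpdate_of_lt y w h, rowUpdate_succ_self]
    have := le_max_left (y k) (rowUpdate y w k (k - 1))
    linarith [hw k]
  · rw [rowUpdate_of_le y w h]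

theorem rowUpdate_mono {y w : ℕ → ℝ} (hw : ∀ i, 0 ≤ w i) {j i : ℕ} (h : i + 1 < j) :
    rowUpdate y w j i ≤ rowUpdate y w j (i + 1) := by
  rw [rowUpdate_of_lt y w h, rowUpdate_succ_self, rowUpdate_of_lt y w (show i < j by omega)]
  have := le_max_right (y (i + 1)) (rowUpdate y w (i + 1) (i + 1 - 1))
  rw [Nat.add_sub_cancel] at this ⊢
  linarith [hw (i + 1)]

theorem growthRow_mono {N : ℕ} {x : ℕ → ℝ} {w : ℕ → ℕ → ℝ} (hw : ∀ i j, 0 ≤ w i j)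
    (hx : ∀ i, i + 1 < N → x i ≤ x (i + 1)) (r : ℕ) {i : ℕ} (hi : i + 1 < N) :
    growthRow N x w r i ≤ growthRow N x w r (i + 1) := by
  cases r with
  | zero => exact hx i hi
  | succ r => exact rowUpdate_mono (hw r) hi

theorem le_growthRow {N : ℕ} {x : ℕ → ℝ} {w : ℕ → ℕ → ℝ} (hw : ∀ i j, 0 ≤ w i j) (r k : ℕ) :
    x k ≤ growthRow N x w r k := by
  induction r with
  | zero => exact le_rfl
  | succ r ih => exact ih.trans (le_rowUpdate (hw r) N k)

theorem le_of_forall_succ_le {N : ℕ} {y : ℕ → ℝ} (hy : ∀ i, i + 1 < N → y i ≤ y (i + 1))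
    {i j : ℕ} (hij : i ≤ j) (hj : j < N) : y i ≤ y j := by
  induction j, hij using Nat.le_induction with
  | base => exact le_rfl
  | succ n hn ih => exact (ih (by omega)).trans (hy n hj)

theorem measurable_rowUpdate {Ω : Type*} [MeasurableSpace Ω] {Y : Ω → ℕ → ℝ}
    (hY : ∀ k, Measurable fun ω => Y ω k) {w : ℕ → Ω → ℝ} (j : ℕ)
    (hw : ∀ i < j, Measurable (w i)) (k : ℕ) :
    Measurable fun ω => rowUpdate (Y ω) (fun i => w i ω) j k := by
  induction j generalizing k with
  | zero => exact hY k
  | succ j ih =>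
    have ih' := fun k => ih (fun i hi => hw i (by omega)) k
    simp only [rowUpdate, Function.update_apply]
    split_ifs
    · exact ((ih' j).max (ih' (j - 1))).add (hw j (by omega))
    · exact ih' k

theorem measurable_growthRow {Ω : Type*} [MeasurableSpace Ω] {W : ℕ → ℕ → Ω → ℝ} (N : ℕ)
    (x : ℕ → ℝ) (r : ℕ) (hW : ∀ i < r, ∀ j < N, Measurable (W i j)) (k : ℕ) :
    Measurable fun ω => growthRow N x (fun i j => W i j ω) r k := by
  induction r generalizing k with
  | zero => exact measurable_const
  | succ r ih =>
    exact measurable_rowUpdate (ih fun i hi => hW i (by omega)) N (hW r (by omega)) k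

/-! ### Integration along the chain -/

/-- The determinant whose row `i` holds the weighted functions `F i` at `y i`. -/
noncomputable def rowDet (N : ℕ) (b : ℕ → ℝ) (F : ℕ → ℕ → ℝ → ℂ) (y : ℕ → ℝ) : ℂ :=
  Matrix.det (Matrix.of fun i l : Fin N => expWeight (b i) (F i l) (y i))

theorem siteDet_self (N : ℕ) (b : ℕ → ℝ) (F G : ℕ → ℕ → ℝ → ℂ) (y : ℕ → ℝ) :
    siteDet N b F G N y = rowDet N b F y := by
  simp [siteDet, rowDet]

/-- At `j = 0` truncated subtraction makes the reference point `y 0`, the smallest coordinate, so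
every maximum is trivial. -/
theorem siteDet_zero {N : ℕ} (b : ℕ → ℝ) (F G : ℕ → ℕ → ℝ → ℂ) {y : ℕ → ℝ}
    (hy : ∀ i, i + 1 < N → y i ≤ y (i + 1)) : siteDet N b F G 0 y = rowDet N b G y := by
  have h : ∀ i : Fin N, max (y i) (y 0) = y i := fun i =>
    max_eq_left (le_of_forall_succ_le hy (Nat.zero_le _) i.isLt)
  simp [siteDet, rowDet, h]

theorem continuous_siteDet (N : ℕ) (b : ℕ → ℝ) {F G : ℕ → ℕ → ℝ → ℂ}
    (hF : ∀ i l, Continuous (F i l)) (hG : ∀ i l, Continuous (G i l)) (j : ℕ) :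
    Continuous (siteDet N b F G j) := by
  refine Continuous.matrix_det (continuous_matrix fun i l => ?_)
  simp only [Matrix.of_apply]
  split_ifs
  · exact (continuous_expWeight _ (hF i l)).comp (by fun_prop)
  · exact (continuous_expWeight _ (hG i l)).comp (by fun_prop)

theorem norm_det_le {N : ℕ} (A : Matrix (Fin N) (Fin N) ℂ) {C : ℝ} (hA : ∀ i l, ‖A i l‖ ≤ C) :
    ‖A.det‖ ≤ N.factorial • C ^ N := by
  have := Matrix.det_le (A := A) (abv := IsAbsoluteValue.toAbsoluteValue (norm : ℂ → ℝ)) hA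
  simpa using this

theorem IsTower.exists_bound {B : ℝ} {b : ℕ → ℝ} {F : ℕ → ℕ → ℝ → ℂ} (hF : IsTower B b F)
    (N : ℕ) (c : ℝ) :
    ∃ C, ∀ i < N, ∀ l < N, ∀ t, c ≤ t → ‖expWeight (b i) (F i l) t‖ ≤ C := by
  have h : ∀ i l, ∃ C, ∀ t, c ≤ t → ‖expWeight (b i) (F i l) t‖ ≤ C := by
    intro i l
    obtain ⟨C, hC⟩ := (isCompact_Icc (a := c) (b := B)).exists_bound_of_continuousOn
      (continuous_expWeight (b i) (hF.continuous i l)).continuousOn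
    refine ⟨max C 0, fun t ht => ?_⟩
    rcases le_total t B with h | h
    · exact (hC t ⟨ht, h⟩).trans (le_max_left _ _)
    · simp [expWeight, hF.eq_zero i l t h]
  choose C hC using h
  refine ⟨∑ i ∈ Finset.range N, ∑ l ∈ Finset.range N, |C i l|, fun i hi l hl t ht => ?_⟩
  refine (hC i l t ht).trans ((le_abs_self _).trans ?_)
  refine le_trans ?_ (Finset.single_le_sum (f := fun i => ∑ l ∈ Finset.range N, |C i l|)
    (fun i _ => Finset.sum_nonneg fun l _ => abs_nonneg _) (Finset.mem_range.2 hi))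
  exact Finset.single_le_sum (f := fun l => |C i l|) (fun l _ => abs_nonneg _)
    (Finset.mem_range.2 hl)

/-- Integrability for Fubini: tower functions are continuous and vanish far to the right, so only a
lower bound on the coordinates is needed. -/
theorem exists_norm_siteDet_le {B B' : ℝ} {b : ℕ → ℝ} {F G : ℕ → ℕ → ℝ → ℂ} (hF : IsTower B b F)
    (hG : IsTower B' b G) (N : ℕ) (c : ℝ) :
    ∃ C, ∀ j (y : ℕ → ℝ), (∀ i < N, c ≤ y i) → ‖siteDet N b F G j y‖ ≤ C := by
  obtain ⟨C₁, h₁⟩ := hF.exists_bound N c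
  obtain ⟨C₂, h₂⟩ := hG.exists_bound N c
  refine ⟨N.factorial • (max C₁ C₂) ^ N, fun j y hy => norm_det_le _ fun i l => ?_⟩
  simp only [Matrix.of_apply]
  split_ifs
  · exact (h₁ i i.isLt l l.isLt _ (hy i i.isLt)).trans (le_max_left _ _)
  · exact (h₂ i i.isLt l l.isLt _ (le_max_of_le_left (hy i i.isLt))).trans (le_max_right _ _)

section

open MeasureTheory ProbabilityTheory

/-- Independence makes the joint law of state and weight a product; by Fubini the weight is
integrated first, with the state frozen, through `integral_siteDet_update`. -/
theorem integral_siteDet_step {Ω : Type*} [MeasurableSpace Ω] {μ : Measure Ω}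
    [IsProbabilityMeasure μ] {N : ℕ} {B : ℝ} {b : ℕ → ℝ} {F : ℕ → ℕ → ℝ → ℂ}
    (hF : IsTower B b F) {a : ℝ} {j : ℕ} (hj : j < N) (hab : 0 < a + b j)
    {Y : Ω → ℕ → ℝ} (hY : Measurable Y) {W : Ω → ℝ} (hW : Measurable W)
    (hW0 : ∀ ω, 0 ≤ W ω) (hind : IndepFun Y W μ) (hlaw : μ.map W = expMeasure (a + b j))
    {c : ℝ} (hc : ∀ ω, ∀ i < N, c ≤ Y ω i)
    (hmono : ∀ ω, ∀ i : ℕ, j ≤ i → i + 1 < N → Y ω i ≤ Y ω (i + 1)) :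
    ∫ ω, siteDet N b F (fun i l => expTail B a (F i l)) (j + 1)
        (Function.update (Y ω) j (max (Y ω j) (Y ω (j - 1)) + W ω)) ∂μ =
      (a + b j) * ∫ ω, siteDet N b F (fun i l => expTail B a (F i l)) j (Y ω) ∂μ := by
  have hG := hF.expTail (a : ℂ)
  set G : ℕ → ℕ → ℝ → ℂ := fun i l => expTail B a (F i l)
  have hS := continuous_siteDet N b hF.continuous hG.continuous
  set Ψ : (ℕ → ℝ) × ℝ → ℂ := fun p =>
    siteDet N b F G (j + 1) (Function.update p.1 j (max (p.1 j) (p.1 (j - 1)) + p.2)) with hΨ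
  have hup : Continuous fun p : (ℕ → ℝ) × ℝ =>
      Function.update p.1 j (max (p.1 j) (p.1 (j - 1)) + p.2) := by
    refine continuous_fst.update j ?_
    fun_prop
  have hΨc : Continuous Ψ := (hS (j + 1)).comp hup
  have hpair : Measurable fun ω => (Y ω, W ω) := hY.prodMk hW
  have hmap := (indepFun_iff_map_prod_eq_prod_map_map hY.aemeasurable hW.aemeasurable).1 hind
  obtain ⟨C, hC⟩ := exists_norm_siteDet_le hF hG N c
  have hint : Integrable (fun ω => Ψ (Y ω, W ω)) μ := by
    refine Integrable.of_bound (hΨc.measurable.comp hpair).aestronglyMeasurable C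
      (Filter.Eventually.of_forall fun ω => hC _ _ fun i hi => ?_)
    rcases eq_or_ne i j with rfl | h
    · rw [Function.update_self]
      have := (hc ω i hi).trans (le_max_left _ (Y ω (i - 1)))
      linarith [hW0 ω]
    · rw [Function.update_of_ne h]
      exact hc ω i hi
  have hint' : Integrable Ψ ((μ.map Y).prod (μ.map W)) := by
    rw [← hmap]
    exact (integrable_map_measure hΨc.measurable.aestronglyMeasurable hpair.aemeasurable).2 hint
  have hprob : IsProbabilityMeasure (μ.map W) := Measure.isProbabilityMeasure_map hW.aemeasurable
  calc ∫ ω, Ψ (Y ω, W ω) ∂μ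
      = ∫ p, Ψ p ∂(μ.map fun ω => (Y ω, W ω)) :=
        (integral_map hpair.aemeasurable hΨc.measurable.aestronglyMeasurable).symm
    _ = ∫ y, ∫ v, Ψ (y, v) ∂(μ.map W) ∂(μ.map Y) := by rw [hmap, integral_prod Ψ hint']
    _ = ∫ ω, ∫ v, Ψ (Y ω, v) ∂(μ.map W) ∂μ := by
        refine integral_map hY.aemeasurable ?_
        exact (hΨc.measurable.stronglyMeasurable.integral_prod_right (ν := μ.map W)).aestronglyMeasurable
    _ = ∫ ω, (a + b j) * siteDet N b F G j (Y ω) ∂μ := by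
        refine integral_congr_ae (Filter.Eventually.of_forall fun ω => ?_)
        simp only [hlaw, hΨ]
        exact integral_siteDet_update hF hj hab (hmono ω)
    _ = _ := integral_const_mul _ _

/-- The independence of the partially updated row and the next weight. -/
theorem indepFun_rowUpdate {Ω : Type*} [MeasurableSpace Ω] {μ : Measure Ω} {m N : ℕ} {x : ℕ → ℝ}
    {W : ℕ → ℕ → Ω → ℝ} (hW : ∀ i j, Measurable (W i j))
    (hind : iIndepFun (fun q : {q : ℕ × ℕ // q.1 < m ∧ q.2 < N} => W q.1.1 q.1.2) μ)
    {r j : ℕ} (hr : r < m) (hj : j < N) :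
    IndepFun (fun ω => rowUpdate (growthRow N x (fun i j => W i j ω) r) (fun i => W r i ω) j)
      (W r j) μ := by
  rw [IndepFun_iff_Indep]
  set mW : {q : ℕ × ℕ // q.1 < m ∧ q.2 < N} → MeasurableSpace Ω := fun q =>
    MeasurableSpace.comap (W q.1.1 q.1.2) inferInstance
  -- The sites preceding `(r, j)` in lexicographic order: their weights determine the current state.
  set S : Set {q : ℕ × ℕ // q.1 < m ∧ q.2 < N} :=
    {q | q.1.1 < r ∨ q.1.1 = r ∧ q.1.2 < j}
  set T : Set {q : ℕ × ℕ // q.1 < m ∧ q.2 < N} := {⟨(r, j), hr, hj⟩}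
  have hST : Disjoint S T := by
    rw [Set.disjoint_singleton_right]
    simp [S]
  have h := indep_iSup_of_disjoint (m := mW) (fun q => (hW q.1.1 q.1.2).comap_le)
    ((iIndepFun_iff_iIndep _ _ _).1 hind) hST
  have hT : (⨆ q ∈ T, mW q) = MeasurableSpace.comap (W r j) inferInstance := by
    simp only [T, iSup_singleton, mW]
  rw [hT] at h
  refine indep_of_indep_of_le_left h ?_
  have hmeas : ∀ i l, i < r ∨ i = r ∧ l < j → l < N → Measurable[⨆ q ∈ S, mW q] (W i l) := by
    intro i l hil hl
    have him : i < m := by omega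
    have hle : mW ⟨(i, l), him, hl⟩ ≤ ⨆ q ∈ S, mW q :=
      le_iSup₂_of_le (⟨(i, l), him, hl⟩ : {q : ℕ × ℕ // q.1 < m ∧ q.2 < N}) hil le_rfl
    exact (comap_measurable (W i l)).mono hle le_rfl
  rw [← measurable_iff_comap_le]
  refine (@measurable_pi_iff _ _ _ (⨆ q ∈ S, mW q) _ _).2 fun k => ?_
  refine @measurable_rowUpdate Ω (⨆ q ∈ S, mW q) _ (fun k =>
    @measurable_growthRow Ω (⨆ q ∈ S, mW q) W N x r
      (fun i hi l hl => hmeas i l (Or.inl hi) hl) k) (W r) j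
      (fun i hi => hmeas r i (Or.inr ⟨rfl, hi⟩) (by omega)) k

theorem integral_rowDet_growthRow {Ω : Type*} [MeasurableSpace Ω] {μ : Measure Ω}
    [IsProbabilityMeasure μ] {m N : ℕ} {a b : ℕ → ℝ} (hab : ∀ i < m, ∀ j < N, 0 < a i + b j)
    {x : ℕ → ℝ} (hx : ∀ i, i + 1 < N → x i ≤ x (i + 1))
    {W : ℕ → ℕ → Ω → ℝ} (hW : ∀ i j, Measurable (W i j)) (hW0 : ∀ i j ω, 0 ≤ W i j ω)
    (hlaw : ∀ i < m, ∀ j < N, μ.map (W i j) = expMeasure (a i + b j))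
    (hind : iIndepFun (fun q : {q : ℕ × ℕ // q.1 < m ∧ q.2 < N} => W q.1.1 q.1.2) μ)
    {B : ℝ} {F : ℕ → ℕ → ℝ → ℂ} (hF : IsTower B b F) :
    ∫ ω, rowDet N b F (growthRow N x (fun i j => W i j ω) m) ∂μ =
      (∏ i ∈ Finset.range m, ∏ j ∈ Finset.range N, ((a i : ℂ) + b j)) *
        rowDet N b (fun i l => expTails B ((List.range m).map fun k => (a k : ℂ)) (F i l)) x := by
  suffices h : ∀ r ≤ m, ∀ F : ℕ → ℕ → ℝ → ℂ, IsTower B b F →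
      ∫ ω, rowDet N b F (growthRow N x (fun i j => W i j ω) r) ∂μ =
      (∏ i ∈ Finset.range r, ∏ j ∈ Finset.range N, ((a i : ℂ) + b j)) *
        rowDet N b (fun i l => expTails B ((List.range r).map fun k => (a k : ℂ)) (F i l)) x from
    h m le_rfl F hF
  intro r
  induction r with
  | zero =>
    intro _ F _
    simp [growthRow, expTails]
  | succ r ih =>
    intro hr F hF
    have hG := hF.expTail (a r : ℂ)
    set Y : Ω → ℕ → ℝ := fun ω => growthRow N x (fun i j => W i j ω) r with hYdef
    have hmono : ∀ ω i, i + 1 < N → Y ω i ≤ Y ω (i + 1) := fun ω i hi =>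
      growthRow_mono (fun i j => hW0 i j ω) hx r hi
    have hlow : ∀ ω, ∀ i < N, x 0 ≤ Y ω i := fun ω i hi =>
      (le_of_forall_succ_le hx (Nat.zero_le i) hi).trans
        (le_growthRow (fun i j => hW0 i j ω) r i)
    -- `siteDet` interpolates between the two row determinants: `j = N` is the determinant of `F` at
    -- the new row, `j = 0` that of the transformed tower at the old one.
    have hstep : ∀ j ≤ N, ∫ ω, siteDet N b F (fun i l => expTail B (a r) (F i l)) j
          (rowUpdate (Y ω) (fun i => W r i ω) j) ∂μ =
        (∏ j ∈ Finset.range j, ((a r : ℂ) + b j)) *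
          ∫ ω, siteDet N b F (fun i l => expTail B (a r) (F i l)) 0 (Y ω) ∂μ := by
      intro j
      induction j with
      | zero => simp [rowUpdate]
      | succ j ihj =>
        intro hj
        have hmeas : Measurable fun ω => rowUpdate (Y ω) (fun i => W r i ω) j :=
          measurable_pi_iff.2 fun k => measurable_rowUpdate
            (measurable_growthRow N x r fun i _ j _ => hW i j) j (fun i _ => hW r i) k
        have := integral_siteDet_step hF (μ := μ) (a := a r) (j := j) hj (hab r hr j hj) hmeas
          (hW r j) (hW0 r j) (indepFun_rowUpdate hW hind hr hj) (hlaw r hr j hj)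
          (c := x 0)
          (fun ω i hi => (hlow ω i hi).trans (le_rowUpdate (fun i => hW0 r i ω) j i))
          (fun ω i hji hi => by
            rw [rowUpdate_of_le _ _ hji, rowUpdate_of_le _ _ (by omega)]
            exact hmono ω i hi)
        simp only [rowUpdate]
        rw [this, ihj (by omega), Finset.prod_range_succ]
        ring
    have h1 := hstep N le_rfl
    simp only [siteDet_self] at h1
    have h2 : ∀ ω, siteDet N b F (fun i l => expTail B (a r) (F i l)) 0 (Y ω) =
        rowDet N b (fun i l => expTail B (a r) (F i l)) (Y ω) := fun ω =>
      siteDet_zero b F _ (hmono ω)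
    simp only [h2] at h1
    simp only [growthRow]
    rw [h1, ih (by omega) _ hG, Finset.prod_range_succ, List.range_succ]
    simp only [List.map_append, expTails_append, List.map_cons, List.map_nil]
    simp only [expTails, List.foldr]
    ring

/-! ### The tower built from test functions -/

/-- `diffChain b l φ n` is `A_{l-n} ⋯ A_{l-1} φ`, where `A_k u = -(u' + b k u)`. -/
noncomputable def diffChain (b : ℕ → ℝ) (l : ℕ) (φ : ℝ → ℂ) : ℕ → ℝ → ℂ
  | 0 => φ
  | n + 1 => fun t => -(deriv (diffChain b l φ n) t + b (l - 1 - n) * diffChain b l φ n t)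

open scoped ContDiff in
theorem contDiff_diffChain (b : ℕ → ℝ) (l : ℕ) {φ : ℝ → ℂ} (hφ : ContDiff ℝ ∞ φ) (n : ℕ) :
    ContDiff ℝ ∞ (diffChain b l φ n) := by
  induction n with
  | zero => exact hφ
  | succ n ih =>
    have h : ContDiff ℝ ∞ (deriv (diffChain b l φ n)) := (contDiff_infty_iff_deriv.1 ih).2
    exact (h.add (contDiff_const.mul ih)).neg

theorem diffChain_eq_zero (b : ℕ → ℝ) (l : ℕ) {φ : ℝ → ℂ} {O : Set ℝ} (hO : IsOpen O)
    (hφ : ∀ t ∈ O, φ t = 0) (n : ℕ) {t : ℝ} (ht : t ∈ O) : diffChain b l φ n t = 0 := by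
  induction n generalizing t with
  | zero => exact hφ t ht
  | succ n ih =>
    have h : diffChain b l φ n =ᶠ[nhds t] fun _ => 0 := by
      filter_upwards [hO.mem_nhds ht] with s hs using ih hs
    simp [diffChain, h.deriv_eq, ih ht]

/-- A smooth function that vanishes outside `[p, q]`, where `q < B`. -/
structure IsTestFunction (B p q : ℝ) (φ : ℝ → ℂ) : Prop where
  contDiff : ContDiff ℝ (↑(⊤ : ℕ∞)) φ
  eq_zero_of_lt : ∀ t, t < p → φ t = 0
  eq_zero_of_gt : ∀ t, q < t → φ t = 0
  lt : q < B

namespace IsTestFunction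

variable {B p q : ℝ} {φ : ℝ → ℂ}

theorem diffChain_eq_zero (h : IsTestFunction B p q φ) (b : ℕ → ℝ) (l n : ℕ) {t : ℝ}
    (ht : t < p ∨ q < t) : diffChain b l φ n t = 0 :=
  _root_.diffChain_eq_zero b l (O := Set.Iio p ∪ Set.Ioi q) (isOpen_Iio.union isOpen_Ioi)
    (fun t ht => ht.elim (h.eq_zero_of_lt t) (h.eq_zero_of_gt t)) n ht

theorem continuous_diffChain (h : IsTestFunction B p q φ) (b : ℕ → ℝ) (l n : ℕ) :
    Continuous (diffChain b l φ n) :=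
  (contDiff_diffChain b l h.contDiff n).continuous

theorem expTail_diffChain_succ (h : IsTestFunction B p q φ) (b : ℕ → ℝ) (l n : ℕ) (z : ℂ)
    (s : ℝ) : expTail B (-z) (diffChain b l φ (n + 1)) s =
      (z - b (l - 1 - n)) * expTail B (-z) (diffChain b l φ n) s + diffChain b l φ n s := by
  have hc := contDiff_diffChain b l h.contDiff n
  refine expTail_neg_deriv _ z (contDiff_infty_iff_deriv.1 hc).2.continuous (fun s => ?_)
    (h.diffChain_eq_zero b l n (Or.inr h.lt)) s
  exact ((contDiff_infty_iff_deriv.1 hc).1 s).hasDerivAt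

/-- Off `[p, q]` the boundary terms of the repeated integration by parts vanish, so each
differential operator is a pure factor. -/
theorem expTail_diffChain (h : IsTestFunction B p q φ) (b : ℕ → ℝ) (l : ℕ) (z : ℂ) {s : ℝ}
    (hs : s < p ∨ q < s) : expTail B (-z) (diffChain b l φ l) s =
      (∏ k ∈ Finset.range l, (z - b k)) * expTail B (-z) φ s := by
  have key : ∀ n, expTail B (-z) (diffChain b l φ n) s =
      (∏ k ∈ Finset.range n, (z - b (l - 1 - k))) * expTail B (-z) φ s := by
    intro n
    induction n with
    | zero => simp [diffChain]
    | succ n ih =>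
      rw [h.expTail_diffChain_succ, ih, h.diffChain_eq_zero b l n hs, Finset.prod_range_succ]
      ring
  rw [key l, Finset.prod_range_reflect (fun k => z - (b k : ℂ)) l]

end IsTestFunction

theorem expTail_eq_zero_of_le {B q : ℝ} (hq : q ≤ B) (a : ℂ) {u : ℝ → ℂ}
    (hu : ∀ y, q < y → u y = 0) {s : ℝ} (hs : q < s) : expTail B a u s = 0 := by
  rcases hq.eq_or_lt with rfl | hqB
  · rw [expTail, intervalIntegral.integral_symm, intervalIntegral.integral_of_le hs.le,
      MeasureTheory.setIntegral_eq_zero_of_forall_eq_zero, neg_zero]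
    intro y hy
    rw [hu y hy.1, mul_zero]
  · rw [expTail, intervalIntegral.integral_congr (g := fun _ => (0 : ℂ))]
    · simp
    · intro y hy
      have : min s B ≤ y := hy.1
      simp [hu y (lt_of_lt_of_le (lt_min hs hqB) this)]

theorem expTails_eq_zero_of_le {B q : ℝ} (hq : q ≤ B) (L : List ℂ) {u : ℝ → ℂ}
    (hu : ∀ y, q < y → u y = 0) {s : ℝ} (hs : q < s) : expTails B L u s = 0 := by
  induction L generalizing s with
  | nil => exact hu s hs
  | cons a L ih => exact expTail_eq_zero_of_le hq a (fun y hy => ih hy) hs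

/-- The exponents `-b (n-1), …, -b 0`. -/
noncomputable def negRates (b : ℕ → ℝ) (n : ℕ) : List ℂ :=
  (List.range n).reverse.map fun k => -(b k : ℂ)

theorem negRates_succ (b : ℕ → ℝ) (n : ℕ) : negRates b (n + 1) = -(b n : ℂ) :: negRates b n := by
  simp [negRates, List.range_succ]

/-- The tower with columns built from the test functions `φ l`. -/
noncomputable def testTower (B : ℝ) (b : ℕ → ℝ) (φ : ℕ → ℝ → ℂ) (i l : ℕ) : ℝ → ℂ :=
  expTails B (negRates b (i + 1)) (diffChain b l (φ l) l)

theorem isTower_testTower {B : ℝ} (b : ℕ → ℝ) {p q : ℕ → ℝ} {φ : ℕ → ℝ → ℂ}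
    (hφ : ∀ l, IsTestFunction B (p l) (q l) (φ l)) : IsTower B b (testTower B b φ) where
  continuous i l := continuous_expTails B _ ((hφ l).continuous_diffChain b l l)
  hasDerivAt i l s := by
    have h := hasDerivAt_expTail B (-(b (i + 1) : ℂ))
      (continuous_expTails B (negRates b (i + 1)) ((hφ l).continuous_diffChain b l l)) s
    simp only [testTower]
    rw [negRates_succ b (i + 1)]
    refine h.congr_deriv ?_
    simp only [expTails, List.foldr, neg_mul]
  eq_zero i l s hs := expTails_eq_zero_of_le (hφ l).lt.le _
    (fun y hy => (hφ l).diffChain_eq_zero b l l (Or.inr hy)) ((hφ l).lt.trans_le hs)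

/-- Each `expTail B (-b k)` inverts `u ↦ -(u' + b k u)`, and the chain is ordered so that the
outermost differential operator is cancelled first. -/
theorem expTails_negRates {B p q : ℝ} (b : ℕ → ℝ) {φ : ℝ → ℂ} (hφ : IsTestFunction B p q φ)
    {l n : ℕ} (hn : n ≤ l) :
    expTails B (negRates b n) (diffChain b l φ l) = diffChain b l φ (l - n) := by
  induction n with
  | zero => rfl
  | succ n ih =>
    rw [negRates_succ]
    change expTail B _ (expTails B (negRates b n) _) = _
    rw [ih (by omega)]
    obtain ⟨k, rfl⟩ : ∃ k, l = n + 1 + k := ⟨l - (n + 1), by omega⟩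
    ext s
    rw [show n + 1 + k - n = k + 1 by omega, show n + 1 + k - (n + 1) = k by omega,
      hφ.expTail_diffChain_succ, show n + 1 + k - 1 - k = n by omega]
    simp

/-- For `i < l` all tail integrals cancel, leaving `φ l` or derivatives of it, which vanish to the
left of the support. For `i ≥ l` a genuine tail integral remains. -/
theorem testTower_eq_zero_of_lt {B : ℝ} (b : ℕ → ℝ) {p q : ℕ → ℝ} {φ : ℕ → ℝ → ℂ}
    (hφ : ∀ l, IsTestFunction B (p l) (q l) (φ l)) {i l : ℕ} (h : i < l) {s : ℝ}
    (hs : s < p l) : testTower B b φ i l s = 0 := by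
  rw [testTower, expTails_negRates b (hφ l) h]
  exact (hφ l).diffChain_eq_zero b l _ (Or.inl hs)

theorem testTower_eq_zero_of_gt {B : ℝ} (b : ℕ → ℝ) {p q : ℕ → ℝ} {φ : ℕ → ℝ → ℂ}
    (hφ : ∀ l, IsTestFunction B (p l) (q l) (φ l)) (i l : ℕ) {s : ℝ}
    (hs : q l < s) : testTower B b φ i l s = 0 :=
  expTails_eq_zero_of_le (hφ l).lt.le _
    (fun _ hy => (hφ l).diffChain_eq_zero b l l (Or.inr hy)) hs

theorem testTower_self {B : ℝ} (b : ℕ → ℝ) {p q : ℕ → ℝ} {φ : ℕ → ℝ → ℂ}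
    (hφ : ∀ l, IsTestFunction B (p l) (q l) (φ l)) (l : ℕ) :
    testTower B b φ l l = expTail B (-(b l : ℂ)) (φ l) := by
  rw [testTower, negRates_succ]
  change expTail B _ (expTails B (negRates b l) _) = _
  rw [expTails_negRates b (hφ l) le_rfl, Nat.sub_self]
  rfl

/-- For a permutation other than the identity, the smallest moved index `i` has both its image and
its preimage above `i`; the hypothesis at these indices kills one factor of the term. -/
theorem det_eq_prod_diag_of_crossing {N : ℕ} {M : Matrix (Fin N) (Fin N) ℂ}
    (h : ∀ i i' k : Fin N, i < i' → i < k → M i k = 0 ∨ M i' i = 0) :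
    M.det = ∏ i, M i i := by
  rw [← Matrix.det_transpose, Matrix.det_apply']
  rw [Finset.sum_eq_single 1]
  · simp
  · intro σ _ hσ
    obtain ⟨i₀, hi₀⟩ : ∃ i, σ i ≠ i := by
      by_contra hcon
      push Not at hcon
      exact hσ (Equiv.ext hcon)
    obtain ⟨i, hi, hmin⟩ := WellFounded.has_min (wellFounded_lt (α := Fin N)) {i | σ i ≠ i}
      ⟨i₀, hi₀⟩
    have hfix : ∀ k < i, σ k = k := fun k hk => by
      by_contra hne
      exact hmin k hne hk
    have h1 : i < σ i := by
      rcases lt_trichotomy (σ i) i with hlt | heq | hgt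
      · exact absurd (σ.injective (hfix _ hlt)) hlt.ne
      · exact absurd heq hi
      · exact hgt
    have h2 : i < σ.symm i := by
      rcases lt_trichotomy (σ.symm i) i with hlt | heq | hgt
      · have := hfix _ hlt
        rw [Equiv.apply_symm_apply] at this
        exact absurd this.symm hlt.ne
      · exact absurd (by rw [← heq, Equiv.apply_symm_apply, heq]) hi
      · exact hgt
    have : ∏ j, M.transpose (σ j) j = 0 := by
      rcases h i (σ.symm i) (σ i) h2 h1 with h0 | h0
      · exact Finset.prod_eq_zero (Finset.mem_univ i) (by simpa using h0)
      · exact Finset.prod_eq_zero (Finset.mem_univ (σ.symm i)) (by simpa using h0)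
    rw [this, mul_zero]
  · simp

theorem rowDet_testTower {N : ℕ} {B : ℝ} (b : ℕ → ℝ) {p q : ℕ → ℝ} {φ : ℕ → ℝ → ℂ}
    (hφ : ∀ l, IsTestFunction B (p l) (q l) (φ l))
    (hpq : ∀ l l', l < l' → l' < N → q l < p l') {y : ℕ → ℝ}
    (hy : ∀ i, i + 1 < N → y i ≤ y (i + 1)) :
    rowDet N b (testTower B b φ) y =
      ∏ l : Fin N, expWeight (b l) (expTail B (-(b l : ℂ)) (φ l)) (y l) := by
  rw [rowDet, det_eq_prod_diag_of_crossing]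
  · simp [testTower_self b hφ]
  · intro i i' k hi hk
    simp only [Matrix.of_apply, expWeight, mul_eq_zero, Complex.exp_ne_zero, false_or]
    -- Either `y i` is left of the support of column `k`, or `q i < p k ≤ y i ≤ y i'` puts `y i'`
    -- right of the support of column `i`.
    by_cases h : y i < p k
    · exact Or.inl (testTower_eq_zero_of_lt b hφ hk h)
    · refine Or.inr (testTower_eq_zero_of_gt b hφ _ _ ?_)
      have h1 := hpq i k hk k.isLt
      have h2 := le_of_forall_succ_le hy (le_of_lt (show (i : ℕ) < i' from hi)) i'.isLt
      linarith

theorem expTails_testTower {B R : ℝ} (hR : 0 < R) {a b : ℕ → ℝ} {p q : ℕ → ℝ} {φ : ℕ → ℝ → ℂ}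
    (hφ : ∀ l, IsTestFunction B (p l) (q l) (φ l)) {m i : ℕ} (l : ℕ)
    (ha : ∀ k < m, ‖(a k : ℂ)‖ < R) (hb : ∀ k ≤ i, ‖(b k : ℂ)‖ < R) {s : ℝ}
    (hs : s < p l ∨ q l < s) :
    expTails B ((List.range m).map fun k => (a k : ℂ)) (testTower B b φ i l) s =
      (2 * (Real.pi : ℂ) * Complex.I)⁻¹ * ∮ z in C(0, R),
        ((∏ k ∈ Finset.range m, (z + a k)⁻¹) * (∏ k ∈ Finset.range (i + 1), (z - b k)⁻¹) *
          ∏ k ∈ Finset.range l, (z - b k)) * expTail B (-z) (φ l) s := by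
  rw [testTower, ← expTails_append, expTails_eq_circleIntegral hR _
    (by simp [negRates]) ?_ ((hφ l).continuous_diffChain b l l)]
  · congr 1
    refine circleIntegral.integral_congr hR.le fun z _ => ?_
    simp only [(hφ l).expTail_diffChain b l z hs]
    rw [List.map_append, List.prod_append, List.map_map, ← mul_assoc]
    congr 3
    rw [negRates, List.map_map, List.map_reverse, List.prod_reverse,
      Finset.prod_eq_multiset_prod]
    simp [Finset.range_val, Multiset.range, Function.comp_def, sub_eq_add_neg]
  · intro c hc
    rw [List.mem_append] at hc
    rcases hc with hc | hc
    · obtain ⟨k, hk, rfl⟩ := List.mem_map.1 hc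
      exact ha k (List.mem_range.1 hk)
    · obtain ⟨k, hk, rfl⟩ := List.mem_map.1 hc
      rw [norm_neg]
      exact hb k (by simpa [Nat.lt_succ_iff] using hk)

/-! ### Approximation of point masses -/

open Filter Topology

/-- A bump function at the origin of radius `1 / (2 (n + 1))`. -/
noncomputable def smallBump (n : ℕ) : ContDiffBump (0 : ℝ) where
  rIn := 1 / (4 * ((n : ℝ) + 1))
  rOut := 1 / (2 * ((n : ℝ) + 1))
  rIn_pos := by positivity
  rIn_lt_rOut := by
    apply one_div_lt_one_div_of_lt <;> nlinarith [(Nat.cast_nonneg n : (0 : ℝ) ≤ n)]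

/-- The normed bump function of radius `1 / (2 (n + 1))` with centre `c`. -/
noncomputable def bumpAt (n : ℕ) (c y : ℝ) : ℝ := (smallBump n).normed volume (c - y)

theorem bumpAt_nonneg (n : ℕ) (c y : ℝ) : 0 ≤ bumpAt n c y := (smallBump n).nonneg_normed _

theorem contDiff_bumpAt (n : ℕ) (c : ℝ) : ContDiff ℝ (↑(⊤ : ℕ∞)) (bumpAt n c) :=
  (smallBump n).contDiff_normed.comp (contDiff_const.sub contDiff_id)

theorem bumpAt_eq_zero {n : ℕ} {c y : ℝ} (h : 1 / (2 * ((n : ℝ) + 1)) ≤ |c - y|) :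
    bumpAt n c y = 0 := by
  by_contra hne
  have : c - y ∈ Function.support ((smallBump n).normed volume) := hne
  rw [ContDiffBump.support_normed_eq, mem_ball_zero_iff, Real.norm_eq_abs] at this
  exact absurd this (not_lt.2 h)

theorem integral_bumpAt (n : ℕ) (c : ℝ) : ∫ y, bumpAt n c y = 1 := by
  have := integral_sub_left_eq_self ((smallBump n).normed volume) volume c
  rw [ContDiffBump.integral_normed] at this
  exact this

theorem integrable_bumpAt (n : ℕ) (c : ℝ) : Integrable (bumpAt n c) :=
  (smallBump n).integrable_normed.comp_sub_left c

theorem tendsto_radius : Tendsto (fun n : ℕ => 1 / (2 * ((n : ℝ) + 1))) atTop (𝓝 0) := by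
  have := (tendsto_one_div_add_atTop_nhds_zero_nat (𝕜 := ℝ)).const_mul (1 / 2)
  rw [mul_zero] at this
  refine this.congr fun n => ?_
  field_simp

theorem tendsto_integral_bumpAt {c : ℕ → ℝ} {h : ℝ} (hc : Tendsto c atTop (𝓝 h)) {g : ℝ → ℂ}
    (hg : Continuous g) : Tendsto (fun n => ∫ y, bumpAt n (c n) y • g y) atTop (𝓝 (g h)) := by
  have := ContDiffBump.convolution_tendsto_right (μ := volume) (φ := smallBump)
    (g := fun _ => g) (k := c) (x₀ := h) (z₀ := g h) (l := atTop) tendsto_radius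
    (Eventually.of_forall fun _ => hg.aestronglyMeasurable)
    ((hg.tendsto h).comp tendsto_snd) hc
  refine this.congr fun n => ?_
  rw [convolution_eq_swap]
  rfl

theorem intervalIntegral_bumpAt_smul {n : ℕ} {c s B : ℝ} (hs : s < c - 1 / (2 * ((n : ℝ) + 1)))
    (hB : c + 1 / (2 * ((n : ℝ) + 1)) < B) {E : Type*} [NormedAddCommGroup E] [NormedSpace ℝ E]
    (g : ℝ → E) :
    ∫ y in s..B, bumpAt n c y • g y = ∫ y, bumpAt n c y • g y := by
  refine intervalIntegral.integral_eq_integral_of_support_subset fun y hy => ?_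
  have : |c - y| < 1 / (2 * ((n : ℝ) + 1)) := by
    by_contra hcon
    exact hy (by simp [bumpAt_eq_zero (not_lt.1 hcon)])
  rw [abs_lt] at this
  exact ⟨by linarith, by linarith⟩

theorem norm_integral_bumpAt_smul_le {n : ℕ} {c C : ℝ} {g : ℝ → ℂ}
    (hg : ∀ y, |c - y| < 1 / (2 * ((n : ℝ) + 1)) → ‖g y‖ ≤ C) :
    ‖∫ y, bumpAt n c y • g y‖ ≤ C := by
  have h := norm_integral_le_of_norm_le ((integrable_bumpAt n c).mul_const C)
    (f := fun y => bumpAt n c y • g y) (Eventually.of_forall fun y => by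
      rw [norm_smul, Real.norm_of_nonneg (bumpAt_nonneg n c y)]
      by_cases hy : |c - y| < 1 / (2 * ((n : ℝ) + 1))
      · exact mul_le_mul_of_nonneg_left (hg y hy) (bumpAt_nonneg n c y)
      · simp [bumpAt_eq_zero (not_lt.1 hy)])
  rwa [integral_mul_const, integral_bumpAt, one_mul] at h

/-- The upper tail `∫_t^B` of a bump function. -/
noncomputable def bumpTail (B : ℝ) (n : ℕ) (c t : ℝ) : ℝ := ∫ y in t..B, bumpAt n c y

theorem abs_bumpTail_le (B : ℝ) (n : ℕ) (c t : ℝ) : |bumpTail B n c t| ≤ 1 := by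
  rw [bumpTail, ← Real.norm_eq_abs]
  refine intervalIntegral.norm_integral_le_integral_norm_uIoc.trans ?_
  rw [← integral_bumpAt n c]
  have h : ∀ y, ‖bumpAt n c y‖ = bumpAt n c y := fun y => Real.norm_of_nonneg (bumpAt_nonneg n c y)
  simp only [h]
  exact setIntegral_le_integral (integrable_bumpAt n c)
    (Eventually.of_forall (bumpAt_nonneg n c))

theorem bumpTail_eq_one {B : ℝ} {n : ℕ} {c t : ℝ} (ht : t < c - 1 / (2 * ((n : ℝ) + 1)))
    (hB : c + 1 / (2 * ((n : ℝ) + 1)) < B) : bumpTail B n c t = 1 := by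
  have := intervalIntegral_bumpAt_smul ht hB (fun _ => (1 : ℝ))
  simp only [smul_eq_mul, mul_one] at this
  rw [bumpTail, this, integral_bumpAt]

theorem bumpTail_eq_zero {B : ℝ} {n : ℕ} {c t : ℝ} (ht : c + 1 / (2 * ((n : ℝ) + 1)) < t)
    (hB : c + 1 / (2 * ((n : ℝ) + 1)) < B) : bumpTail B n c t = 0 := by
  rw [bumpTail, intervalIntegral.integral_congr (g := fun _ => (0 : ℝ))]
  · simp
  · intro y hy
    have h : min t B ≤ y := hy.1
    have h' := lt_of_lt_of_le (lt_min ht hB) h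
    refine bumpAt_eq_zero ?_
    rw [abs_sub_comm]
    exact le_trans (by linarith) (le_abs_self _)

/-- The test function `y ↦ e^{-b y} ρ y`, where `ρ` is a bump function with centre `c`. -/
noncomputable def bumpTest (b : ℝ) (n : ℕ) (c y : ℝ) : ℂ :=
  Complex.exp (-b * y) * bumpAt n c y

theorem isTestFunction_bumpTest {B : ℝ} (b : ℝ) {n : ℕ} {c : ℝ}
    (hB : c + 1 / (2 * ((n : ℝ) + 1)) < B) :
    IsTestFunction B (c - 1 / (2 * ((n : ℝ) + 1))) (c + 1 / (2 * ((n : ℝ) + 1)))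
      (bumpTest b n c) where
  contDiff := by
    have h1 : ContDiff ℝ (↑(⊤ : ℕ∞)) fun y : ℝ => (y : ℂ) := Complex.ofRealCLM.contDiff
    have h2 : ContDiff ℝ (↑(⊤ : ℕ∞)) fun y : ℝ => (bumpAt n c y : ℂ) :=
      Complex.ofRealCLM.contDiff.comp (contDiff_bumpAt n c)
    exact (contDiff_const.mul h1).cexp.mul h2
  eq_zero_of_lt t ht := by
    rw [bumpTest, bumpAt_eq_zero]
    · simp
    · exact le_trans (by linarith) (le_abs_self _)
  eq_zero_of_gt t ht := by
    rw [bumpTest, bumpAt_eq_zero]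
    · simp
    · rw [abs_sub_comm]
      exact le_trans (by linarith) (le_abs_self _)
  lt := hB

/-- The factor `e^{-b y}` in the test function is there to cancel the row weight and the tail
kernel, so that diagonal entries are smoothed indicators. -/
theorem expWeight_expTail_bumpTest (B b : ℝ) (n : ℕ) (c t : ℝ) :
    expWeight b (expTail B (-(b : ℂ)) (bumpTest b n c)) t = (bumpTail B n c t : ℝ) := by
  rw [expWeight, expTail, ← intervalIntegral.integral_const_mul, bumpTail,
    ← intervalIntegral.integral_ofReal]
  congr 1
  ext y
  rw [bumpTest, ← mul_assoc, ← mul_assoc, ← Complex.exp_add, ← Complex.exp_add]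
  have : (b : ℂ) * t + - -(b : ℂ) * (y - t) + -b * y = 0 := by ring
  rw [this, Complex.exp_zero, one_mul]

theorem expTail_bumpTest {B b : ℝ} {n : ℕ} {c s : ℝ} (hs : s < c - 1 / (2 * ((n : ℝ) + 1)))
    (hB : c + 1 / (2 * ((n : ℝ) + 1)) < B) (z : ℂ) :
    expTail B (-z) (bumpTest b n c) s =
      ∫ y, bumpAt n c y • Complex.exp (z * ((y : ℂ) - s) - b * y) := by
  rw [← intervalIntegral_bumpAt_smul hs hB, expTail]
  congr 1
  ext y
  rw [bumpTest, ← mul_assoc, ← Complex.exp_add, Complex.real_smul, mul_comm]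
  congr 2
  ring

/-- The limit of contour integrals against test functions that approximate a point mass. -/
theorem tendsto_circleIntegral_expTail_bumpTest {B R b : ℝ} (hR : 0 < R) {c : ℕ → ℝ} {h s : ℝ}
    (hc : Tendsto c atTop (𝓝 h)) (hs : ∀ n, s < c n - 1 / (2 * ((n : ℝ) + 1)))
    (hB : ∀ n, c n + 1 / (2 * ((n : ℝ) + 1)) < B) {r : ℂ → ℂ}
    (hr : ContinuousOn r (Metric.sphere 0 R)) :
    Tendsto (fun n => ∮ z in C(0, R), r z * expTail B (-z) (bumpTest b n (c n)) s) atTop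
      (𝓝 (∮ z in C(0, R), r z * Complex.exp (z * ((h : ℂ) - s) - b * h))) := by
  obtain ⟨C₁, hC₁⟩ := (isCompact_sphere (0 : ℂ) R).exists_bound_of_continuousOn hr
  have hg : Continuous fun p : ℂ × ℝ => Complex.exp (p.1 * ((p.2 : ℂ) - s) - b * p.2) := by
    fun_prop
  obtain ⟨C₂, hC₂⟩ := ((isCompact_sphere (0 : ℂ) R).prod
    (isCompact_Icc (a := s) (b := B))).exists_bound_of_continuousOn hg.continuousOn
  have hmem : ∀ θ : ℝ, circleMap 0 R θ ∈ Metric.sphere (0 : ℂ) R := fun θ =>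
    circleMap_mem_sphere 0 hR.le θ
  have hrc : Continuous fun θ : ℝ => r (circleMap 0 R θ) :=
    hr.comp_continuous (continuous_circleMap 0 R) hmem
  simp only [circleIntegral]
  refine intervalIntegral.tendsto_integral_filter_of_dominated_convergence
    (fun _ => R * (C₁ * C₂)) (Eventually.of_forall fun n => ?_)
    (Eventually.of_forall fun n => Eventually.of_forall fun θ _ => ?_)
    intervalIntegrable_const (Eventually.of_forall fun θ _ => ?_)
  · refine Continuous.aestronglyMeasurable ?_
    have h1 : Continuous fun z => expTail B (-z) (bumpTest b n (c n)) s :=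
      (differentiable_expTail_neg B
        (isTestFunction_bumpTest b (hB n)).contDiff.continuous s).continuous
    simp only [deriv_circleMap, smul_eq_mul]
    exact ((continuous_circleMap 0 R).mul continuous_const).mul
      (hrc.mul (h1.comp (continuous_circleMap 0 R)))
  · have h0 : ‖deriv (circleMap 0 R) θ‖ = R := by
      simp [deriv_circleMap, abs_of_pos hR]
    rw [norm_smul, h0, norm_mul, expTail_bumpTest (hs n) (hB n)]
    refine mul_le_mul_of_nonneg_left (mul_le_mul (hC₁ _ (hmem θ)) ?_ (norm_nonneg _)
      ((norm_nonneg _).trans (hC₁ _ (hmem θ)))) hR.le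
    refine norm_integral_bumpAt_smul_le fun y hy => hC₂ (circleMap 0 R θ, y) ⟨hmem θ, ?_⟩
    rw [abs_lt] at hy
    have h1 := hs n
    have h2 := hB n
    exact ⟨by linarith, by linarith⟩
  · refine Tendsto.const_smul (Tendsto.const_mul _ ?_) _
    have := tendsto_integral_bumpAt hc
      (g := fun y => Complex.exp (circleMap 0 R θ * ((y : ℂ) - s) - b * y)) (by fun_prop)
    exact this.congr fun n => (expTail_bumpTest (hs n) (hB n) _).symm

/-! ### The distribution of a row -/

/-- The centres of the test functions: increasing in `l`, above `h l`, and with limit `h l`. -/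
noncomputable def bumpCentre (N : ℕ) (h : ℕ → ℝ) (n l : ℕ) : ℝ :=
  h l + 2 * ((min l N : ℕ) + 1) * (1 / ((n : ℝ) + 1))

theorem tendsto_bumpCentre (N : ℕ) (h : ℕ → ℝ) (l : ℕ) :
    Tendsto (fun n => bumpCentre N h n l) atTop (𝓝 (h l)) := by
  have := ((tendsto_one_div_add_atTop_nhds_zero_nat (𝕜 := ℝ)).const_mul
    (2 * (((min l N : ℕ) : ℝ) + 1))).const_add (h l)
  simpa [bumpCentre] using this

theorem radius_eq (n : ℕ) : 1 / (2 * ((n : ℝ) + 1)) = (1 / ((n : ℝ) + 1)) / 2 := by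
  field_simp

theorem lt_bumpCentre_sub (N : ℕ) (h : ℕ → ℝ) (n l : ℕ) :
    h l < bumpCentre N h n l - 1 / (2 * ((n : ℝ) + 1)) := by
  have hε : 0 < 1 / ((n : ℝ) + 1) := by positivity
  have hl : (0 : ℝ) ≤ (min l N : ℕ) := Nat.cast_nonneg _
  rw [radius_eq, bumpCentre]
  nlinarith

/-- Capping the index at `N` in the centres makes one `B` serve all `l` and all `n`. -/
theorem bumpCentre_add_lt {N : ℕ} {h : ℕ → ℝ} {B : ℝ} (hB : ∀ l, h l + 2 * (N + 2) ≤ B)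
    (n l : ℕ) : bumpCentre N h n l + 1 / (2 * ((n : ℝ) + 1)) < B := by
  have hε : 0 < 1 / ((n : ℝ) + 1) := by positivity
  have hε1 : 1 / ((n : ℝ) + 1) ≤ 1 := by
    rw [div_le_one (by positivity)]
    linarith [(Nat.cast_nonneg n : (0 : ℝ) ≤ n)]
  have hl : (0 : ℝ) ≤ (min l N : ℕ) := Nat.cast_nonneg _
  have hl' : ((min l N : ℕ) : ℝ) ≤ N := by exact_mod_cast min_le_right l N
  have := hB l
  rw [radius_eq, bumpCentre]
  nlinarith

/-- Consecutive shifts differ by `2/(n+1)`, more than the bump width `1/(n+1)`, so supports are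
disjoint and ordered even when heights coincide. -/
theorem bumpCentre_lt {N : ℕ} {h : ℕ → ℝ} (hh : ∀ l l', l < l' → l' < N → h l ≤ h l')
    (n : ℕ) {l l' : ℕ} (hl : l < l') (hl' : l' < N) :
    bumpCentre N h n l + 1 / (2 * ((n : ℝ) + 1)) <
      bumpCentre N h n l' - 1 / (2 * ((n : ℝ) + 1)) := by
  have hε : 0 < 1 / ((n : ℝ) + 1) := by positivity
  have h1 := hh l l' hl hl'
  have h2 : (l : ℝ) + 1 ≤ l' := by exact_mod_cast hl
  rw [radius_eq, bumpCentre, bumpCentre, min_eq_left hl'.le, min_eq_left (hl.trans hl').le]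
  nlinarith

/-- The contour integral in the entry `(i, l)` of the determinant. -/
noncomputable def contourEntry (m : ℕ) (a b x h : ℕ → ℝ) (R : ℝ) (i l : ℕ) : ℂ :=
  (2 * (Real.pi : ℂ) * Complex.I)⁻¹ * ∮ z in C(0, R),
    ((∏ k ∈ Finset.range m, (z + a k)⁻¹) * (∏ k ∈ Finset.range (i + 1), (z - b k)⁻¹) *
      ∏ k ∈ Finset.range l, (z - b k)) * Complex.exp (z * ((h l : ℂ) - x i) - b l * h l)

/-- The distribution function of a row as a determinant. -/
theorem measureReal_growthRow_le {Ω : Type*} [MeasurableSpace Ω] {μ : Measure Ω}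
    [IsProbabilityMeasure μ] {m N : ℕ} {a b : ℕ → ℝ} (hab : ∀ i < m, ∀ j < N, 0 < a i + b j)
    {R : ℝ} (hR : 0 < R) (ha : ∀ k < m, ‖(a k : ℂ)‖ < R) (hb : ∀ k < N, ‖(b k : ℂ)‖ < R)
    {x : ℕ → ℝ} (hx : ∀ i, i + 1 < N → x i ≤ x (i + 1))
    {W : ℕ → ℕ → Ω → ℝ} (hW : ∀ i j, Measurable (W i j)) (hW0 : ∀ i j ω, 0 ≤ W i j ω)
    (hlaw : ∀ i < m, ∀ j < N, μ.map (W i j) = expMeasure (a i + b j))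
    (hind : iIndepFun (fun q : {q : ℕ × ℕ // q.1 < m ∧ q.2 < N} => W q.1.1 q.1.2) μ)
    {h : ℕ → ℝ} (hh : ∀ l l', l < l' → l' < N → h l ≤ h l') {C : ℝ} (hC : ∀ l, h l ≤ C) :
    ((μ.real {ω | ∀ l : Fin N, growthRow N x (fun i j => W i j ω) m l ≤ h l} : ℝ) : ℂ) =
      (∏ i ∈ Finset.range m, ∏ j ∈ Finset.range N, ((a i : ℂ) + b j)) *
        Matrix.det (Matrix.of fun i l : Fin N =>
          if x i ≤ h l then Complex.exp ((b i : ℂ) * x i) * contourEntry m a b x h R i l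
          else 0) := by
  set B : ℝ := C + 2 * (N + 2) with hBdef
  have hB : ∀ l, h l + 2 * (N + 2) ≤ B := fun l => by
    have := hC l
    linarith
  have hcB := bumpCentre_add_lt hB
  set φ : ℕ → ℕ → ℝ → ℂ := fun n l => bumpTest (b l) n (bumpCentre N h n l) with hφdef
  have hφ : ∀ n l, IsTestFunction B (bumpCentre N h n l - 1 / (2 * ((n : ℝ) + 1)))
      (bumpCentre N h n l + 1 / (2 * ((n : ℝ) + 1))) (φ n l) := fun n l =>
    isTestFunction_bumpTest (b l) (hcB n l)
  have hup : ∀ l s, h l < s →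
      ∀ᶠ n : ℕ in atTop, bumpCentre N h n l + 1 / (2 * ((n : ℝ) + 1)) < s := by
    intro l s hs
    have := (tendsto_bumpCentre N h l).add tendsto_radius
    rw [add_zero] at this
    exact this.eventually_lt_const hs
  set Y : Ω → ℕ → ℝ := fun ω => growthRow N x (fun i j => W i j ω) m with hYdef
  have hYm : Measurable Y := measurable_pi_iff.2 fun k =>
    measurable_growthRow N x m (fun i _ j _ => hW i j) k
  have hYmono : ∀ ω i, i + 1 < N → Y ω i ≤ Y ω (i + 1) := fun ω i hi =>
    growthRow_mono (fun i j => hW0 i j ω) hx m hi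
  have hdet : ∀ n ω, rowDet N b (testTower B b (φ n)) (Y ω) =
      ∏ l : Fin N, ((bumpTail B n (bumpCentre N h n l) (Y ω l) : ℝ) : ℂ) := by
    intro n ω
    rw [rowDet_testTower b (hφ n) (fun l l' => bumpCentre_lt hh n) (hYmono ω)]
    exact Finset.prod_congr rfl fun l _ => expWeight_expTail_bumpTest B (b l) n _ _
  have hS : MeasurableSet {ω | ∀ l : Fin N, Y ω l ≤ h l} := by
    rw [Set.ofPred_forall]
    exact MeasurableSet.iInter fun l => measurableSet_le
      ((measurable_pi_apply (l : ℕ)).comp hYm) measurable_const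
  have hleft : Tendsto (fun n => ∫ ω, rowDet N b (testTower B b (φ n)) (Y ω) ∂μ) atTop
      (𝓝 ((μ.real {ω | ∀ l : Fin N, Y ω l ≤ h l} : ℝ) : ℂ)) := by
    have hind : ((μ.real {ω | ∀ l : Fin N, Y ω l ≤ h l} : ℝ) : ℂ) =
        ∫ ω, {ω | ∀ l : Fin N, Y ω l ≤ h l}.indicator (fun _ => (1 : ℂ)) ω ∂μ := by
      rw [integral_indicator_const _ hS, Complex.real_smul, mul_one]
    rw [hind]
    refine tendsto_integral_of_dominated_convergence (fun _ => 1) (fun n => ?_)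
      (integrable_const _) (fun n => Eventually.of_forall fun ω => ?_)
      (Eventually.of_forall fun ω => ?_)
    · have hT := isTower_testTower b (hφ n)
      have := continuous_siteDet N b hT.continuous hT.continuous N
      simp only [← siteDet_self N b _ (testTower B b (φ n))]
      exact (this.measurable.comp hYm).aestronglyMeasurable
    · rw [hdet, norm_prod]
      refine Finset.prod_le_one (fun l _ => norm_nonneg _) fun l _ => ?_
      rw [Complex.norm_real]
      exact abs_bumpTail_le _ _ _ _
    · simp only [hdet]
      -- The bumps sit strictly to the right of `h l`, so the smoothed indicator equals `1` even at
      -- `Y ω l = h l`, matching the closed event.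
      by_cases hω : ∀ l : Fin N, Y ω l ≤ h l
      · rw [Set.indicator_of_mem (show ω ∈ {ω | ∀ l : Fin N, Y ω l ≤ h l} from hω)]
        refine tendsto_const_nhds.congr fun n => ?_
        refine (Finset.prod_eq_one fun l _ => ?_).symm
        rw [bumpTail_eq_one ((hω l).trans_lt (lt_bumpCentre_sub N h n l)) (hcB n l),
          Complex.ofReal_one]
      · rw [Set.indicator_of_notMem (show ω ∉ {ω | ∀ l : Fin N, Y ω l ≤ h l} from hω)]
        push Not at hω
        obtain ⟨l, hl⟩ := hω
        refine tendsto_const_nhds.congr' ?_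
        filter_upwards [hup l _ hl] with n hn
        refine (Finset.prod_eq_zero (Finset.mem_univ l) ?_).symm
        rw [bumpTail_eq_zero hn (hcB n l), Complex.ofReal_zero]
  have hright : Tendsto (fun n => (∏ i ∈ Finset.range m, ∏ j ∈ Finset.range N, ((a i : ℂ) + b j)) *
      rowDet N b (fun i l => expTails B ((List.range m).map fun k => (a k : ℂ))
        (testTower B b (φ n) i l)) x) atTop
      (𝓝 ((∏ i ∈ Finset.range m, ∏ j ∈ Finset.range N, ((a i : ℂ) + b j)) *
        Matrix.det (Matrix.of fun i l : Fin N =>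
          if x i ≤ h l then Complex.exp ((b i : ℂ) * x i) * contourEntry m a b x h R i l
          else 0))) := by
    refine Tendsto.const_mul _ ?_
    have hcont : Continuous fun A : Matrix (Fin N) (Fin N) ℂ => A.det :=
      Continuous.matrix_det continuous_id
    refine (hcont.tendsto _).comp (tendsto_pi_nhds.2 fun i => tendsto_pi_nhds.2 fun l => ?_)
    simp only [Matrix.of_apply, expWeight]
    -- If `x i ≤ h l`, every bump lies to the right of `x i` and the contour formula passes to the
    -- limit. Otherwise the support is eventually to the left of `x i` and the entry is zero.
    split_ifs with hil
    · refine Tendsto.const_mul _ ?_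
      have hlt : ∀ n : ℕ, x i < bumpCentre N h n l - 1 / (2 * ((n : ℝ) + 1)) := fun n =>
        hil.trans_lt (lt_bumpCentre_sub N h n l)
      have hbi : ∀ k ≤ (i : ℕ), ‖(b k : ℂ)‖ < R := fun k hk => hb k (hk.trans_lt i.isLt)
      have hrc : ContinuousOn (fun z : ℂ => (∏ k ∈ Finset.range m, (z + a k)⁻¹) *
          (∏ k ∈ Finset.range ((i : ℕ) + 1), (z - b k)⁻¹) *
          ∏ k ∈ Finset.range (l : ℕ), (z - b k)) (Metric.sphere 0 R) := by
        refine ContinuousOn.mul (ContinuousOn.mul ?_ ?_) (by fun_prop)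
        · refine continuousOn_finsetProd _ fun k hk => ContinuousOn.inv₀ (by fun_prop)
            fun z hz => add_ne_zero_of_mem_sphere (ha k (Finset.mem_range.1 hk)) hz
        · refine continuousOn_finsetProd _ fun k hk => ContinuousOn.inv₀ (by fun_prop)
            fun z hz => ?_
          rw [sub_eq_add_neg]
          refine add_ne_zero_of_mem_sphere ?_ hz
          rw [norm_neg]
          exact hbi k (Nat.lt_succ_iff.1 (Finset.mem_range.1 hk))
      have := (tendsto_circleIntegral_expTail_bumpTest (b := b l) hR (tendsto_bumpCentre N h l)
        hlt (fun n => hcB n l) hrc).const_mul (2 * (Real.pi : ℂ) * Complex.I)⁻¹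
      refine this.congr fun n => ?_
      exact (expTails_testTower hR (hφ n) l ha hbi (Or.inl (hlt n))).symm
    · refine tendsto_const_nhds.congr' ?_
      filter_upwards [hup l _ (not_le.1 hil)] with n hn
      rw [expTails_eq_zero_of_le (hcB n l).le _
        (fun y hy => testTower_eq_zero_of_gt b (hφ n) i l hy) hn, mul_zero]
  refine tendsto_nhds_unique hleft (hright.congr fun n => ?_)
  exact (integral_rowDet_growthRow hab hx hW hW0 hlaw hind (isTower_testTower b (hφ n))).symm

/-! ### Comparison with the growth function and the contour integrals -/

/-- Since `c ≤ x 1` and weights are nonnegative, the boundary never wins the maximum in the first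
column. `rowUpdate` encodes this by letting site `0` be its own left neighbour (`0 - 1 = 0`). -/
theorem lppGrowth_eq_growthRow {m N : ℕ} {c : EReal} {x : ℕ → ℝ} (hc : c ≤ (x 1 : EReal))
    {w W : ℕ → ℕ → ℝ} (hW : ∀ i j, 0 ≤ W i j)
    (hwW : ∀ i < m, ∀ j < N, w (i + 1) (j + 1) = W i j) {r : ℕ} (hr : r ≤ m) {j : ℕ} (hj : j < N) :
    lppGrowth c x w r (j + 1) = (growthRow N (fun i => x (i + 1)) W r j : EReal) := by
  induction r generalizing j with
  | zero => simp [lppGrowth, growthRow]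
  | succ r ih =>
    set Y := growthRow N (fun i => x (i + 1)) W r with hY
    have hlow : x 1 ≤ Y 0 := le_growthRow (x := fun i => x (i + 1)) hW r 0
    have hgrow : ∀ k < N, growthRow N (fun i => x (i + 1)) W (r + 1) k =
        max (Y k) (rowUpdate Y (W r) k (k - 1)) + W r k := fun k hk => by
      rw [growthRow, rowUpdate_of_lt _ _ hk, rowUpdate_succ_self]
    induction j with
    | zero =>
      have hle : c ≤ (Y 0 : EReal) := hc.trans (EReal.coe_le_coe_iff.2 hlow)
      have h0 : lppGrowth c x w (r + 1) 0 = c := by simp [lppGrowth]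
      rw [lppGrowth, ih (by omega) hj, h0, max_eq_left hle, hwW r (by omega) 0 hj, hgrow 0 hj]
      simp [rowUpdate]
    | succ k ihk =>
      have hk := ihk (by omega)
      rw [growthRow, rowUpdate_of_lt _ _ (show k < N by omega)] at hk
      rw [lppGrowth, ih (by omega) hj, hk, hwW r (by omega) (k + 1) hj, hgrow (k + 1) hj,
        Nat.add_sub_cancel, EReal.coe_add, EReal.coe_strictMono.monotone.map_max]

theorem exists_mem_Ioc_of_strictMono {N p : ℕ} {n : Fin (p + 1) → ℕ} (hn0 : n 0 = 0)
    (hnp : n (Fin.last p) = N) {j : ℕ} (hj0 : 0 < j) (hjN : j ≤ N) :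
    ∃ k : Fin p, j ∈ Finset.Ioc (n k.castSucc) (n k.succ) := by
  have key : ∀ t : Fin (p + 1), j ≤ n t →
      ∃ k : Fin p, j ∈ Finset.Ioc (n k.castSucc) (n k.succ) := by
    intro t
    induction t using Fin.induction with
    | zero => intro h; omega
    | succ k ih =>
      intro h
      by_cases hk : j ≤ n k.castSucc
      · exact ih hk
      · exact ⟨k, Finset.mem_Ioc.2 ⟨not_le.1 hk, h⟩⟩
  exact key (Fin.last p) (hnp ▸ hjN)

theorem stepHeight_mono {N p : ℕ} {n : Fin (p + 1) → ℕ} (hn : StrictMono n) (hn0 : n 0 = 0)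
    (hnp : n (Fin.last p) = N) {h : Fin p → ℝ} (hh : Monotone h) {j j' : ℕ} (hj : 0 < j)
    (hjj' : j ≤ j') (hj' : j' ≤ N) : stepHeight n h j ≤ stepHeight n h j' := by
  obtain ⟨k, hk⟩ := exists_mem_Ioc_of_strictMono hn0 hnp hj (hjj'.trans hj')
  obtain ⟨k', hk'⟩ := exists_mem_Ioc_of_strictMono hn0 hnp (hj.trans_le hjj') hj'
  rw [stepHeight_eq hn h k hk, stepHeight_eq hn h k' hk']
  refine hh (not_lt.1 fun hlt => ?_)
  have := hn.monotone (show k'.succ ≤ k.castSucc from hlt)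
  rw [Finset.mem_Ioc] at hk hk'
  omega

theorem stepHeight_le_sum {p : ℕ} (n : Fin (p + 1) → ℕ) (h : Fin p → ℝ) (j : ℕ) :
    stepHeight n h j ≤ ∑ k, |h k| := by
  refine Finset.sum_le_sum fun k _ => ?_
  split_ifs
  · exact le_abs_self _
  · exact abs_nonneg _

/-- A row is increasing, so a bound at the right end of a block of constant height holds on the
whole block. -/
theorem forall_le_iff_forall_le_stepHeight {N p : ℕ} {n : Fin (p + 1) → ℕ} (hn : StrictMono n)
    (hn0 : n 0 = 0) (hnp : n (Fin.last p) = N) (h : Fin p → ℝ) {y : ℕ → ℝ}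
    (hy : ∀ i, i + 1 < N → y i ≤ y (i + 1)) :
    (∀ k : Fin p, y (n k.succ - 1) ≤ h k) ↔ ∀ l : Fin N, y l ≤ stepHeight n h (l + 1) := by
  have hle : ∀ k : Fin p, n k.castSucc < n k.succ ∧ n k.succ ≤ N := fun k =>
    ⟨hn k.castSucc_lt_succ, hnp ▸ hn.monotone (Fin.le_last _)⟩
  constructor
  · intro H l
    obtain ⟨k, hk⟩ := exists_mem_Ioc_of_strictMono hn0 hnp (Nat.succ_pos l) l.isLt
    rw [stepHeight_eq hn h k hk]
    rw [Finset.mem_Ioc] at hk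
    have := hle k
    exact (le_of_forall_succ_le hy (by omega) (by omega)).trans (H k)
  · intro H k
    have := hle k
    have h1 := H ⟨n k.succ - 1, by omega⟩
    rwa [show n k.succ - 1 + 1 = n k.succ by omega,
      stepHeight_eq hn h k (Finset.mem_Ioc.2 ⟨this.1, le_rfl⟩)] at h1

theorem prod_Icc_one_eq_prod_range {M : Type*} [CommMonoid M] (f : ℕ → M) (n : ℕ) :
    ∏ k ∈ Finset.Icc 1 n, f k = ∏ k ∈ Finset.range n, f (k + 1) := by
  induction n with
  | zero => simp
  | succ n ih => rw [Finset.prod_Icc_succ_top (by omega), ih, Finset.prod_range_succ]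

theorem FExp_eq_contourEntry {R : ℝ} (m : ℕ) (α β x H : ℕ → ℝ) (i l : ℕ) :
    FExp m α β x H R (i + 1) (l + 1) =
      (∏ k ∈ Finset.range m, ((α (k + 1) : ℂ) + β (l + 1))) *
        (Complex.exp ((β (i + 1) : ℂ) * x (i + 1)) *
          contourEntry m (fun k => α (k + 1)) (fun k => β (k + 1)) (fun k => x (k + 1))
            (fun k => H (k + 1)) R i l) := by
  rw [FExp, contourEntry]
  set P := ∏ k ∈ Finset.range m, ((α (k + 1) : ℂ) + β (l + 1)) with hP
  set Q := Complex.exp ((β (i + 1) : ℂ) * x (i + 1)) with hQ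
  have : ∀ T J : ℂ, P * (Q * (T * J)) = T * (P * Q * J) := fun T J => by ring
  rw [this, ← circleIntegral.integral_const_mul (P * Q)]
  congr 1
  refine congrArg (fun f : ℂ → ℂ => circleIntegral f 0 R) (funext fun z => ?_)
  simp only [prod_Icc_one_eq_prod_range, Nat.add_sub_cancel, Finset.prod_div_distrib, ← hP,
    Finset.prod_inv_distrib]
  have he : Complex.exp ((H (l + 1) : ℂ) * (z - β (l + 1)) - x (i + 1) * (z - β (i + 1))) =
      Q * Complex.exp (z * ((H (l + 1) : ℂ) - x (i + 1)) - β (l + 1) * H (l + 1)) := by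
    rw [hQ, ← Complex.exp_add]
    congr 1
    ring
  rw [he, div_eq_mul_inv, div_eq_mul_inv]
  ring

theorem ae_nonneg_expMeasure (r : ℝ) : ∀ᵐ v ∂(expMeasure r), 0 ≤ v := by
  rw [ae_iff]
  have : {v : ℝ | ¬ 0 ≤ v} = Set.Iio 0 := by
    ext v
    simp
  rw [this]
  change (volume.withDensity (exponentialPDF r)) (Set.Iio 0) = 0
  rw [withDensity_apply _ measurableSet_Iio, lintegral_exponentialPDF_of_nonpos le_rfl]

/-- A random variable with an exponential law has a measurable nonnegative modification. -/
theorem exists_measurable_nonneg_of_hasLaw {Ω : Type*} [MeasurableSpace Ω] {μ : Measure Ω} {r : ℝ}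
    {X : Ω → ℝ} (hX : HasLaw X (expMeasure r) μ) :
    ∃ V : Ω → ℝ, Measurable V ∧ (∀ ω, 0 ≤ V ω) ∧ V =ᵐ[μ] X := by
  refine ⟨fun ω => |hX.aemeasurable.mk X ω|, hX.aemeasurable.measurable_mk.abs,
    fun ω => abs_nonneg _, ?_⟩
  have h0 : ∀ᵐ ω ∂μ, 0 ≤ X ω := by
    refine ae_of_ae_map hX.aemeasurable ?_
    rw [hX.map_eq]
    exact ae_nonneg_expMeasure r
  filter_upwards [h0, hX.aemeasurable.ae_eq_mk] with ω h1 h2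
  rw [← h2, abs_of_nonneg h1]

/-- The distribution of the growth function for at least one column. -/
theorem measureReal_lppGrowth_le
    {Ω : Type*} [MeasurableSpace Ω] (μ : Measure Ω) [IsProbabilityMeasure μ]
    {m N p : ℕ} {α β : ℕ → ℝ}
    (hα : ∀ i ∈ Finset.Icc 1 m, 0 ≤ α i) (hβ : ∀ j ∈ Finset.Icc 1 N, 0 ≤ β j)
    (hαβ : ∀ i ∈ Finset.Icc 1 m, ∀ j ∈ Finset.Icc 1 N, 0 < α i + β j)
    {w : ℕ → ℕ → Ω → ℝ}
    (hlaw : ∀ i ∈ Finset.Icc 1 m, ∀ j ∈ Finset.Icc 1 N,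
      HasLaw (w i j) (expMeasure (α i + β j)) μ)
    (hindep : iIndepFun
      (fun q : {q : ℕ × ℕ // q.1 ∈ Finset.Icc 1 m ∧ q.2 ∈ Finset.Icc 1 N} => w q.1.1 q.1.2) μ)
    {x : ℕ → ℝ} (hx : MonotoneOn x (Set.Icc 1 N)) {c : EReal} (hc : c ≤ (x 1 : EReal))
    {n : Fin (p + 1) → ℕ} (hn : StrictMono n) (hn0 : n 0 = 0) (hnp : n (Fin.last p) = N)
    {h : Fin p → ℝ} (hh : Monotone h) {R : ℝ} (hR : 0 < R)
    (hRα : ∀ i ∈ Finset.Icc 1 m, α i < R) (hRβ : ∀ j ∈ Finset.Icc 1 N, β j < R) :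
    ((μ.real {ω | ∀ k : Fin p,
        lppGrowth c x (fun i j => w i j ω) m (n k.succ) ≤ (h k : EReal)} : ℝ) : ℂ) =
      Matrix.det (Matrix.of fun i j : Fin N =>
        if x (i + 1) ≤ stepHeight n h (j + 1) then
          FExp m α β x (stepHeight n h) R (i + 1) (j + 1)
        else 0) := by
  have hmem : ∀ {k M : ℕ}, k < M → k + 1 ∈ Finset.Icc 1 M := fun hk =>
    Finset.mem_Icc.2 ⟨by omega, by omega⟩
  have hV : ∀ i j, ∃ V : Ω → ℝ, Measurable V ∧ (∀ ω, 0 ≤ V ω) ∧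
      (i < m → j < N → V =ᵐ[μ] w (i + 1) (j + 1)) := by
    intro i j
    by_cases hij : i < m ∧ j < N
    · obtain ⟨V, h1, h2, h3⟩ :=
        exists_measurable_nonneg_of_hasLaw (hlaw (i + 1) (hmem hij.1) (j + 1) (hmem hij.2))
      exact ⟨V, h1, h2, fun _ _ => h3⟩
    -- Zero outside the grid keeps measurability and nonnegativity valid for all indices.
    · exact ⟨fun _ => 0, measurable_const, fun _ => le_rfl, fun h1 h2 => absurd ⟨h1, h2⟩ hij⟩
  choose W hW hW0 hWw using hV
  set x' : ℕ → ℝ := fun i => x (i + 1)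
  have hx' : ∀ i, i + 1 < N → x' i ≤ x' (i + 1) := fun i hi =>
    hx ⟨by omega, by omega⟩ ⟨by omega, by omega⟩ (by omega)
  have hindW : iIndepFun (fun q : {q : ℕ × ℕ // q.1 < m ∧ q.2 < N} => W q.1.1 q.1.2) μ := by
    have h1 := hindep.precomp
      (g := fun q : {q : ℕ × ℕ // q.1 < m ∧ q.2 < N} =>
        ⟨(q.1.1 + 1, q.1.2 + 1), hmem q.2.1, hmem q.2.2⟩) (fun q q' hq => by
          have h2 := congrArg Subtype.val hq
          simp only [Prod.mk.injEq, Nat.add_right_cancel_iff] at h2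
          exact Subtype.ext (Prod.ext h2.1 h2.2))
    exact h1.congr fun q => (hWw q.1.1 q.1.2 q.2.1 q.2.2).symm
  have hlawW : ∀ i < m, ∀ j < N, μ.map (W i j) = expMeasure (α (i + 1) + β (j + 1)) := by
    intro i hi j hj
    rw [Measure.map_congr (hWw i j hi hj)]
    exact (hlaw (i + 1) (hmem hi) (j + 1) (hmem hj)).map_eq
  have hnorm : ∀ t : ℝ, 0 ≤ t → t < R → ‖(t : ℂ)‖ < R := fun t h0 hR => by
    rwa [Complex.norm_real, Real.norm_of_nonneg h0]
  have key := measureReal_growthRow_le (a := fun i => α (i + 1)) (b := fun j => β (j + 1))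
    (m := m) (N := N) (h := fun l => stepHeight n h (l + 1))
    (fun i hi j hj => hαβ _ (hmem hi) _ (hmem hj)) hR
    (fun k hk => hnorm _ (hα _ (hmem hk)) (hRα _ (hmem hk)))
    (fun k hk => hnorm _ (hβ _ (hmem hk)) (hRβ _ (hmem hk))) hx' hW hW0 hlawW hindW
    (fun l l' hl hl' => stepHeight_mono hn hn0 hnp hh (by omega) (by omega) hl')
    (fun l => stepHeight_le_sum n h (l + 1))
  have hev : {ω | ∀ k : Fin p,
        lppGrowth c x (fun i j => w i j ω) m (n k.succ) ≤ (h k : EReal)} =ᵐ[μ]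
      {ω | ∀ l : Fin N, growthRow N x' (fun i j => W i j ω) m l ≤ stepHeight n h (l + 1)} := by
    have hae : ∀ᵐ ω ∂μ, ∀ i j, i < m → j < N → W i j ω = w (i + 1) (j + 1) ω := by
      rw [ae_all_iff]
      intro i
      rw [ae_all_iff]
      intro j
      by_cases hij : i < m ∧ j < N
      · filter_upwards [hWw i j hij.1 hij.2] with ω hω _ _ using hω
      · exact Filter.Eventually.of_forall fun ω h1 h2 => absurd ⟨h1, h2⟩ hij
    refine Filter.eventuallyEq_set.2 ?_
    filter_upwards [hae] with ω hω
    have hmono : ∀ i, i + 1 < N → growthRow N x' (fun i j => W i j ω) m i ≤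
        growthRow N x' (fun i j => W i j ω) m (i + 1) := fun i hi =>
      growthRow_mono (fun i j => hW0 i j ω) hx' m hi
    change (∀ k : Fin p, lppGrowth c x (fun i j => w i j ω) m (n k.succ) ≤ (h k : EReal)) ↔
      ∀ l : Fin N, growthRow N x' (fun i j => W i j ω) m l ≤ stepHeight n h (l + 1)
    rw [← forall_le_iff_forall_le_stepHeight hn hn0 hnp h hmono]
    refine forall_congr' fun k => ?_
    have h1 : n k.castSucc < n k.succ := hn k.castSucc_lt_succ
    have h2 : n k.succ ≤ N := hnp ▸ hn.monotone (Fin.le_last _)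
    have h3 := lppGrowth_eq_growthRow (w := fun i j => w i j ω) (W := fun i j => W i j ω) hc
      (fun i j => hW0 i j ω) (fun i hi j hj => (hω i j hi hj).symm) le_rfl
      (show n k.succ - 1 < N by omega)
    rw [Nat.sub_add_cancel (by omega)] at h3
    rw [h3, EReal.coe_le_coe_iff]
  -- The prefactor is regrouped by `j` and its `j`-th part `∏_i (α_i + β_j)` is absorbed into column
  -- `j`.
  rw [measureReal_congr hev, key, Finset.prod_comm, ← Fin.prod_univ_eq_prod_range
    (fun j => ∏ i ∈ Finset.range m, ((α (i + 1) : ℂ) + β (j + 1))) N, ← Matrix.det_mul_row]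
  congr 1
  ext i l
  simp only [Matrix.of_apply, x']
  split_ifs
  · exact (FExp_eq_contourEntry m α β x (stepHeight n h) i l).symm
  · exact mul_zero _

end

theorem mainTheorem10
    {Ω : Type*} [MeasurableSpace Ω] (μ : MeasureTheory.Measure Ω)
    [MeasureTheory.IsProbabilityMeasure μ]
    (m N p : ℕ) (α β : ℕ → ℝ)
    (hα : ∀ i ∈ Finset.Icc 1 m, 0 ≤ α i) (hβ : ∀ j ∈ Finset.Icc 1 N, 0 ≤ β j)
    (hαβ : ∀ i ∈ Finset.Icc 1 m, ∀ j ∈ Finset.Icc 1 N, 0 < α i + β j)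
    -- independent exponential weights `w i j`, `1 ≤ i ≤ m`, `1 ≤ j ≤ N`, of rate `α i + β j`
    (w : ℕ → ℕ → Ω → ℝ)
    (hlaw : ∀ i ∈ Finset.Icc 1 m, ∀ j ∈ Finset.Icc 1 N,
      ProbabilityTheory.HasLaw (w i j) (ProbabilityTheory.expMeasure (α i + β j)) μ)
    (hindep : ProbabilityTheory.iIndepFun
      (fun q : {q : ℕ × ℕ // q.1 ∈ Finset.Icc 1 m ∧ q.2 ∈ Finset.Icc 1 N} => w q.1.1 q.1.2) μ)
    -- initial condition `x 1 ≤ x 2 ≤ ⋯ ≤ x N` and boundary value `c ∈ [-∞, x 1]`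
    (x : ℕ → ℝ) (hx : MonotoneOn x (Set.Icc 1 N))
    (c : EReal) (hc : c ≤ (x 1 : EReal))
    -- `0 = n 0 < n 1 < ⋯ < n p = N` and `h_1 ≤ ⋯ ≤ h_p`
    (n : Fin (p + 1) → ℕ) (hn : StrictMono n) (hn0 : n 0 = 0) (hnp : n (Fin.last p) = N)
    (h : Fin p → ℝ) (hh : Monotone h)
    -- the radius of the contour
    (R : ℝ) (hRα : ∀ i ∈ Finset.Icc 1 m, α i < R) (hRβ : ∀ j ∈ Finset.Icc 1 N, β j < R) :
    -- the formula when all the heights are at least `x N`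
    ((∀ k : Fin p, x N ≤ h k) →
      ((μ.real {ω | ∀ k : Fin p,
          lppGrowth c x (fun i j => w i j ω) m (n k.succ) ≤ (h k : EReal)} : ℝ) : ℂ) =
        Matrix.det (Matrix.of fun i j : Fin N =>
          FExp m α β x (stepHeight n h) R (i + 1) (j + 1))) ∧
    -- the formula in general, where the entries with `h(j) < x_i` are zero
    ((μ.real {ω | ∀ k : Fin p,
        lppGrowth c x (fun i j => w i j ω) m (n k.succ) ≤ (h k : EReal)} : ℝ) : ℂ) =
      Matrix.det (Matrix.of fun i j : Fin N =>
        if x (i + 1) ≤ stepHeight n h (j + 1) then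
          FExp m α β x (stepHeight n h) R (i + 1) (j + 1)
        else 0) := by
  have general : ((μ.real {ω | ∀ k : Fin p,
        lppGrowth c x (fun i j => w i j ω) m (n k.succ) ≤ (h k : EReal)} : ℝ) : ℂ) =
      Matrix.det (Matrix.of fun i j : Fin N =>
        if x (i + 1) ≤ stepHeight n h (j + 1) then
          FExp m α β x (stepHeight n h) R (i + 1) (j + 1)
        else 0) := by
    -- For `N = 0` also `p = 0`, so the event is everything and the determinant is empty. For `N >
    -- 0`, positivity of `R` follows from `0 ≤ β 1 < R`.
    rcases Nat.eq_zero_or_pos N with rfl | hN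
    · have hp : p = 0 := by
        have := hn.injective (hn0.trans hnp.symm)
        simpa using (congrArg Fin.val this).symm
      subst hp
      simp
    · have h1 : 1 ∈ Finset.Icc 1 N := Finset.mem_Icc.2 ⟨le_rfl, hN⟩
      exact measureReal_lppGrowth_le μ hα hβ hαβ hlaw hindep hx hc hn hn0 hnp hh
        ((hβ 1 h1).trans_lt (hRβ 1 h1)) hRα hRβ
  refine ⟨fun hxh => ?_, general⟩
  rw [general]
  congr 1
  ext i j
  simp only [Matrix.of_apply]
  obtain ⟨k, hk⟩ := exists_mem_Ioc_of_strictMono hn0 hnp (Nat.succ_pos j) j.isLt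
  rw [if_pos]
  rw [stepHeight_eq hn h k hk]
  have hi := i.isLt
  exact (hx (Set.mem_Icc.2 ⟨Nat.le_add_left 1 i, hi⟩)
    (Set.mem_Icc.2 ⟨by omega, le_rfl⟩) hi).trans (hxh k)
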